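/- Let $d\ge 3$, let $\mathcal H=\mathbb C^d$ (for $N$ qubits, $d=2^N$), and let $\|\cdot\|_\infty$ denote the operator norm and $\|\cdot\|_2$ the Hilbert--Schmidt norm of an operator, and the Euclidean norm of a vector in $\mathbb R^M$. Consider a parameterized circuit $$|\psi(\theta)\rangle=U_M(\theta_M)W_M\cdots U_1(\theta_1)W_1|\psi_0\rangle,\qquad U_\mu(\theta_\mu)=e^{-i\Omega_\mu\theta_\mu},\qquad \theta\in\mathbb R^M,$$ with Hermitian generators $\Omega_\mu$, fixed unitaries $W_\mu$ and a unit input vector $|\psi_0\rangle$. Fix $\theta^*\in\mathbb R^M$, write $\psi^*=\psi(\theta^*)$ and $\langle A\rangle_*=\langle\psi^*|A|\psi^*\rangle$, and let $$\omega=(\|\Omega_1\|_\infty,\dots,\|\Omega_M\|_\infty),\qquad \mathcal F_{\mu\nu}=2\operatorname{Re}\big[\langle\partial_\mu\psi|\partial_\nu\psi\rangle-\langle\partial_\mu\psi|\psi\rangle\langle\psi|\partial_\nu\psi\rangle\big].$$ Let $e^*$ be the smallest eigenvalue of the quantum Fisher information matrix $\mathcal F$ at $\theta^*$. Let $H$ be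 a Hermitian operator on $\mathcal H$, let $\mathbb V$ be the ensemble of random unitaries $V=|\psi^*\rangle\langle\psi^*|+PVP$, where $P=I-|\psi^*\rangle\langle\psi^*|$ and $PVP$ is distributed according to the Haar probability measure on the unitary group of the orthogonal complement of $\psi^*$, and consider the random loss function $$\mathcal L(\theta)=\langle\psi(\theta)|V^\dagger HV|\psi(\theta)\rangle ,$$ whose value $\mathcal L^*=\mathcal L(\theta^*)=\langle H\rangle_*$ does not depend on $V$. For $\epsilon=(\epsilon_1,\epsilon_2)$ let $\operatorname{LocalMin}(\theta^*,\epsilon)$ be the event that $|\partial_\mu\mathcal L(\theta^*)|\le\epsilon_1$ for all $\mu$ and that the Hessian of $\mathcal L$ at $\theta^*$ satisfies $H_{\mathcal L}\succ-\epsilon_2 I$. Put $$f_1(H,d)=\frac{\langle H^2\rangle_*-\langle H\rangle_*^2}{d-1},\qquad f_2(H,d)=32\left(\frac{\langle H^2\rangle_*-\langle H\rangle_*^2}{d-1}+\frac{2\|H\|_2^2}{d(d-2)}\right).$$ (a) Suppose $\mathcal L^*<\frac{\operatorname{tr}H}{d}$, $\epsilon_1>0$ and $\frac{\operatorname{tr}H-d\mathcal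 L^*}{d-1}e^*+\epsilon_2>0$ (for instance $\epsilon_2>0$). Then $$\Pr_{\mathbb V}\big[\neg\operatorname{LocalMin}(\theta^*,\epsilon)\big]\le\frac{2f_1(H,d)\|\omega\|_2^2}{\epsilon_1^2}+\frac{f_2(H,d)\|\omega\|_2^4}{\left(\frac{\operatorname{tr}H-d\mathcal L^*}{d-1}e^*+\epsilon_2\right)^2}.$$ (b) If $(H_N)_N$ is a sequence of Hermitian operators on $\mathbb C^{2^N}$ with $\|H_N\|_\infty\in O(\operatorname{poly}(N))$, then for any unit vectors $\psi^*_N\in\mathbb C^{2^N}$, defining $\langle\cdot\rangle_*$ by $\psi^*_N$, both $f_1(H_N,2^N)$ and $f_2(H_N,2^N)$ are $O(\operatorname{poly}(N)2^{-N})$ as $N\to\infty$. -/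

import Mathlib

open MeasureTheory Filter Topology Asymptotics

noncomputable section

/-- The Hilbert space `ℂ^d` (for `N` qubits, `d = 2 ^ N`). -/
abbrev Hil (d : ℕ) : Type := EuclideanSpace ℂ (Fin d)

/-- Linear operators on `ℂ^d`. The norm is the operator norm `‖·‖_∞`, and `star` is the adjoint. -/
abbrev Op (d : ℕ) : Type := Hil d →L[ℂ] Hil d

/-- The (real part of the) trace; the trace is real for self-adjoint `A`. -/
def Op.tr {d : ℕ} (A : Op d) : ℝ := (LinearMap.trace ℂ (Hil d) A.toLinearMap).re

/-- The squared Schatten 2-norm (Hilbert-Schmidt norm) `‖A‖₂² = tr (A† A)`. -/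
def Op.hsNormSq {d : ℕ} (A : Op d) : ℝ := Op.tr (star A * A)

/-- `⟨φ| A |φ⟩` (its real part; the value is real for self-adjoint `A`). -/
def Op.avg {d : ℕ} (A : Op d) (φ : Hil d) : ℝ := (inner ℂ φ (A φ)).re

/-! ### Parameterized quantum circuits -/

/-- A quantum neural network with `M` trainable parameters: Hermitian generators `Ω_μ`,
non-parameterized unitary gates `W_μ` and a normalized input state. -/
structure QNN (d M : ℕ) where
  generator : Fin M → Op d
  generator_selfAdjoint : ∀ μ, IsSelfAdjoint (generator μ)
  gate : Fin M → Op d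
  gate_unitary : ∀ μ, gate μ ∈ unitary (Op d)
  input : Hil d
  input_norm : ‖input‖ = 1

/-- The partial derivative `∂_μ f (θ)`. -/
def partialD {M : ℕ} {F : Type*} [NormedAddCommGroup F] [NormedSpace ℝ F]
    (μ : Fin M) (f : (Fin M → ℝ) → F) (θ : Fin M → ℝ) : F :=
  lineDeriv ℝ f θ (Pi.single μ 1)

/-- The Hessian matrix of `f` at `θ`. -/
def hessianMatrix {M : ℕ} (f : (Fin M → ℝ) → ℝ) (θ : Fin M → ℝ) : Matrix (Fin M) (Fin M) ℝ :=
  Matrix.of fun μ ν => partialD μ (partialD ν f) θ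

/-- `θ` is a local minimum of `L` up to precision `(ε₁, ε₂)`: every gradient component is at most
`ε₁` in absolute value and the Hessian satisfies `H_L ≻ -ε₂ I`. -/
def LocalMin {M : ℕ} (L : (Fin M → ℝ) → ℝ) (θ : Fin M → ℝ) (ε₁ ε₂ : ℝ) : Prop :=
  (∀ μ, |partialD μ L θ| ≤ ε₁) ∧
    (hessianMatrix L θ + ε₂ • (1 : Matrix (Fin M) (Fin M) ℝ)).PosDef

/-- The smallest eigenvalue of a real symmetric matrix. -/
def minEigenvalue {M : ℕ} (A : Matrix (Fin M) (Fin M) ℝ) : ℝ := sInf (spectrum ℝ A)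

namespace QNN

variable {d M : ℕ} (Q : QNN d M)

/-- The layer `U_μ(t) W_μ` with `U_μ(t) = exp (-i t Ω_μ)`. -/
def layer (μ : Fin M) (t : ℝ) : Op d :=
  NormedSpace.exp ((-(Complex.I * (t : ℂ))) • Q.generator μ) * Q.gate μ

/-- The circuit `U_M(θ_M) W_M ⋯ U_1(θ_1) W_1`. -/
def circuit (θ : Fin M → ℝ) : Op d :=
  (List.ofFn fun μ => Q.layer μ (θ μ)).reverse.prod

/-- The output state `|ψ(θ)⟩`. -/
def state (θ : Fin M → ℝ) : Hil d := Q.circuit θ Q.input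

/-- The energy loss `⟨ψ(θ)| A |ψ(θ)⟩` of an observable `A`. -/
def energyLoss (A : Op d) (θ : Fin M → ℝ) : ℝ := A.avg (Q.state θ)

/-- The quantum Fisher information matrix
`2 Re [⟨∂_μ ψ|∂_ν ψ⟩ - ⟨∂_μ ψ|ψ⟩⟨ψ|∂_ν ψ⟩]`. -/
def qfi (θ : Fin M → ℝ) : Matrix (Fin M) (Fin M) ℝ :=
  Matrix.of fun μ ν =>
    2 * (inner ℂ (partialD μ Q.state θ) (partialD ν Q.state θ)
      - inner ℂ (partialD μ Q.state θ) (Q.state θ)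
        * inner ℂ (Q.state θ) (partialD ν Q.state θ)).re

/-- The generator norm vector `ω = (‖Ω_1‖_∞, …, ‖Ω_M‖_∞)` with its Euclidean norm. -/
def omega : EuclideanSpace ℝ (Fin M) := WithLp.toLp 2 fun μ => ‖Q.generator μ‖

end QNN

/-! ### The Haar ensemble on an orthogonal complement -/

/-- The unitary group of a Hilbert space. -/
abbrev UnitaryOps (K : Type*) [NormedAddCommGroup K] [InnerProductSpace ℂ K] [CompleteSpace K] :
    Type _ :=
  unitary (K →L[ℂ] K)

/-- The unitary group of a finite-dimensional Hilbert space is compact. -/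
instance UnitaryOps.instCompactSpace (K : Type*) [NormedAddCommGroup K] [InnerProductSpace ℂ K]
    [CompleteSpace K] [FiniteDimensional ℂ K] : CompactSpace (UnitaryOps K) := by
  have : ProperSpace (K →L[ℂ] K) := FiniteDimensional.proper ℂ _
  refine isCompact_iff_compactSpace.mp
    (Metric.isCompact_of_isClosed_isBounded isClosed_unitary ?_)
  refine (Metric.isBounded_closedBall (x := 0) (r := 1)).subset ?_
  intro U hU
  rw [mem_closedBall_zero_iff]
  refine ContinuousLinearMap.opNorm_le_bound _ zero_le_one fun x => ?_
  rw [one_mul]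
  exact (ContinuousLinearMap.norm_map_of_mem_unitary hU x).le

/-- The Haar probability measure on the unitary group of a finite-dimensional Hilbert space. -/
def haarUnitary (K : Type*) [NormedAddCommGroup K] [InnerProductSpace ℂ K]
    [CompleteSpace K] [FiniteDimensional ℂ K] : Measure (UnitaryOps K) :=
  Measure.haarMeasure ⊤

/-- The orthogonal complement `ψ^⊥` of the line spanned by `ψ`. -/
abbrev orthCompl {d : ℕ} (ψ : Hil d) : Submodule ℂ (Hil d) := (Submodule.span ℂ {ψ})ᗮ

/-- The block-diagonal unitary `V = P̄ + P u P`, where `P` is the projector onto `ψ^⊥`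
and `P̄ = 1 - P` (which is `|ψ⟩⟨ψ|` for a unit vector `ψ`). -/
def blockUnitary {d : ℕ} (ψ : Hil d) (u : UnitaryOps (orthCompl ψ)) : Op d :=
  (1 - (orthCompl ψ).starProjection) +
    (orthCompl ψ).subtypeL ∘L
      (u : orthCompl ψ →L[ℂ] orthCompl ψ) ∘L (orthCompl ψ).orthogonalProjectionOnto

/-! ### The coefficient functions -/

/-- `f₁(H, d) = (⟨H²⟩_* - ⟨H⟩_*²) / (d - 1)` with `⟨·⟩_*` the average in the state `ψ`. -/
def f₁ {d : ℕ} (H : Op d) (ψ : Hil d) : ℝ :=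
  ((H ^ 2).avg ψ - H.avg ψ ^ 2) / ((d : ℝ) - 1)

/-- `f₂(H, d) = 32 ((⟨H²⟩_* - ⟨H⟩_*²) / (d - 1) + 2 ‖H‖₂² / (d (d - 2)))`. -/
def f₂ {d : ℕ} (H : Op d) (ψ : Hil d) : ℝ :=
  32 * (((H ^ 2).avg ψ - H.avg ψ ^ 2) / ((d : ℝ) - 1)
    + 2 * H.hsNormSq / ((d : ℝ) * ((d : ℝ) - 2)))

end

/-! Every `V` in the ensemble fixes `ψ*` and acts on `ψ*^⊥`, of dimension `D = d - 1`, as a Haar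
unitary `u`. Let `t_μ` be the part of `∂_μ ψ` in `ψ*^⊥`, let `h` be the projection of `H ψ*` there,
so that `‖h‖²` is the variance of `H`, and let `T` be the compression of `H` to `ψ*^⊥`. The gradient
is then `2 Re⟨u t_μ, h⟩`. With `c = (tr H - d L*)/(d - 1)`, the difference Hessian `- c F` is `2
Re⟨u w, h⟩ + 2 (Re⟨u t_ν, T u t_μ⟩ - m Re⟨t_ν, t_μ⟩)`, where `w` is a curvature vector and `m = c +
L*` is the normalized trace of `T` (`partialD_randomLoss`, `hessianMatrix_randomLoss_sub`). So the
gradient is centred at `0` and the Hessian at `c F`, which is at least `c e*` because `L* < tr H /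
d` makes `c` positive.

It remains to bound second moments. Left invariance of Haar measure suffices: transitivity on unit
vectors gives the second moment of a coordinate, a polarization inequality bounds its fourth moment,
and permuting an eigenbasis of `T - m` reduces the quadratic term to two numbers
(`integral_haarUnitary_fluctuation_sq_le`).

Markov's inequality is applied to each squared gradient component and to the squared Frobenius norm
of Hessian `- c F`. Frobenius deviation below `c e* + ε₂` already forces `H_L ≻ -ε₂ I`
(`posDef_add_smul_one_of_sum_sq_lt`), and a union bound gives (a). Part (b) follows from `‖H‖₂² ≤ d
‖H‖_∞²`. -/

section ReverseProd

/-- Isolates the dependence of the circuit on a single parameter: all other layers are absorbed in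
the constants `a` and `b`, so a partial derivative is an ordinary derivative of one factor. -/
theorem List.exists_reverse_prod_ofFn_update {A : Type*} [Monoid A] {M : ℕ} (f : Fin M → A)
    (ν : Fin M) : ∃ a b : A, ∀ x,
      (List.ofFn (Function.update f ν x)).reverse.prod = a * x * b := by
  induction M with
  | zero => exact ν.elim0
  | succ n ih =>
    refine Fin.cases ?_ (fun i => ?_) ν
    · refine ⟨(List.ofFn fun i : Fin n => f i.succ).reverse.prod, 1, fun x => ?_⟩
      simp [List.ofFn_succ, Function.update_of_ne, Fin.succ_ne_zero]
    · obtain ⟨a, b, h⟩ := ih (fun i => f i.succ) i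
      refine ⟨a, b * f 0, fun x => ?_⟩
      have : (fun j : Fin n => Function.update f i.succ x j.succ) =
          Function.update (fun j => f j.succ) i x := by
        ext j
        by_cases hj : j = i
        · subst hj; simp
        · simp [Function.update_of_ne, hj]
      rw [List.ofFn_succ, this, List.reverse_cons, List.prod_append, h,
        Function.update_of_ne (Fin.succ_ne_zero i).symm]
      simp [mul_assoc]

theorem List.norm_reverse_prod_ofFn_le {A : Type*} [NormedRing A] [NormOneClass A] {M : ℕ}
    (f : Fin M → A) : ‖(List.ofFn f).reverse.prod‖ ≤ ∏ i, ‖f i‖ := by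
  refine (List.norm_prod_le _).trans_eq ?_
  rw [List.map_reverse, List.prod_reverse, List.map_ofFn, List.prod_ofFn]
  rfl

end ReverseProd

/-! ### Derivatives of the circuit, its state and its loss -/

namespace QNN

variable {d M : ℕ} (Q : QNN d M)

theorem layer_mem_unitary (μ : Fin M) (t : ℝ) : Q.layer μ t ∈ unitary (Op d) := by
  refine mul_mem ?_ (Q.gate_unitary μ)
  have ht : IsSelfAdjoint (-(t : ℂ)) := by
    rw [isSelfAdjoint_iff, star_neg, Complex.star_def, Complex.conj_ofReal]
  have h : IsSelfAdjoint ((-(t : ℂ)) • Q.generator μ) := ht.smul (Q.generator_selfAdjoint μ)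
  have := (selfAdjoint.expUnitary (⟨_, h⟩ : selfAdjoint (Op d))).2
  rw [selfAdjoint.expUnitary_coe, smul_smul, mul_neg] at this
  exact this

theorem hasDerivAt_layer (μ : Fin M) (t : ℝ) :
    HasDerivAt (Q.layer μ) ((-Complex.I) • Q.generator μ * Q.layer μ t) t := by
  have h := (hasDerivAt_exp_smul_const' (𝕂 := ℝ) ((-Complex.I) • Q.generator μ) t).mul_const
    (Q.gate μ)
  have e : ∀ s : ℝ, s • ((-Complex.I) • Q.generator μ) =
      (-(Complex.I * (s : ℂ))) • Q.generator μ := fun s => by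
    have h1 : s • ((-Complex.I) • Q.generator μ) = (s : ℂ) • ((-Complex.I) • Q.generator μ) :=
      ContinuousLinearMap.ext fun x =>
        (Complex.coe_smul s (((-Complex.I) • Q.generator μ) x)).symm
    rw [h1, smul_smul]; congr 1; ring
  simp only [e] at h
  rw [mul_assoc] at h
  exact h

/-- The circuit with `k μ` extra factors `-i Ω_μ` in front of the `μ`-th layer: its mixed partial
derivatives. -/
noncomputable def derivCircuit (k : Fin M → ℕ) (θ : Fin M → ℝ) : Op d :=
  (List.ofFn fun μ => ((-Complex.I) • Q.generator μ) ^ k μ * Q.layer μ (θ μ)).reverse.prod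

theorem derivCircuit_zero (θ : Fin M → ℝ) : Q.derivCircuit 0 θ = Q.circuit θ := by
  simp [derivCircuit, circuit]

/-- Each layer solves `U' = -iΩ U`, so differentiating raises one exponent of the multi-index. The
family `derivCircuit` is therefore closed under partial derivatives, and both orders of derivative
come from this one rule. -/
theorem hasLineDerivAt_derivCircuit (k : Fin M → ℕ) (θ : Fin M → ℝ) (ν : Fin M) :
    HasLineDerivAt ℝ (Q.derivCircuit k) (Q.derivCircuit (k + Pi.single ν 1) θ) θ
      (Pi.single ν 1) := by
  let f : Fin M → Op d := fun μ => ((-Complex.I) • Q.generator μ) ^ k μ * Q.layer μ (θ μ)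
  obtain ⟨a, b, hab⟩ := List.exists_reverse_prod_ofFn_update f ν
  have h1 : ∀ t : ℝ, Q.derivCircuit k (θ + t • Pi.single ν 1) =
      a * (((-Complex.I) • Q.generator ν) ^ k ν * Q.layer ν (θ ν + t)) * b := by
    intro t
    rw [← hab, derivCircuit]
    congr 3
    ext1 μ
    by_cases h : μ = ν
    · subst h; simp
    · simp [h, f]
  have h2 : Q.derivCircuit (k + Pi.single ν 1) θ =
      a * (((-Complex.I) • Q.generator ν) ^ k ν *
        ((-Complex.I) • Q.generator ν * Q.layer ν (θ ν))) * b := by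
    rw [← hab, derivCircuit]
    congr 3
    ext1 μ
    by_cases h : μ = ν
    · subst h; simp only [Pi.add_apply, Pi.single_eq_same, Function.update_self, pow_succ, mul_assoc]
    · simp [h, f]
  rw [HasLineDerivAt, h2]
  simp only [h1]
  have h3 : HasDerivAt (fun t : ℝ => Q.layer ν (θ ν + t))
      ((-Complex.I) • Q.generator ν * Q.layer ν (θ ν)) 0 := by
    have := Q.hasDerivAt_layer ν (θ ν + 0)
    simpa using this.comp_const_add (θ ν) 0
  exact ((h3.const_mul _).const_mul a).mul_const b

theorem norm_derivCircuit_le [NeZero d] (k : Fin M → ℕ) (θ : Fin M → ℝ) :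
    ‖Q.derivCircuit k θ‖ ≤ ∏ μ, ‖Q.generator μ‖ ^ k μ := by
  refine (List.norm_reverse_prod_ofFn_le _).trans ?_
  refine Finset.prod_le_prod (fun _ _ => norm_nonneg _) fun μ _ => ?_
  have h1 : ‖Q.layer μ (θ μ)‖ ≤ 1 := by
    refine ContinuousLinearMap.opNorm_le_bound _ zero_le_one fun x => ?_
    rw [one_mul]
    exact (ContinuousLinearMap.norm_map_of_mem_unitary (Q.layer_mem_unitary μ _) x).le
  calc _ ≤ ‖((-Complex.I) • Q.generator μ) ^ k μ‖ * ‖Q.layer μ (θ μ)‖ := norm_mul_le _ _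
    _ ≤ ‖(-Complex.I) • Q.generator μ‖ ^ k μ * 1 := by
        gcongr
        exact norm_pow_le _ _
    _ = _ := by rw [norm_smul]; simp

/-- The mixed partial derivatives of the output state. -/
noncomputable def derivState (k : Fin M → ℕ) (θ : Fin M → ℝ) : Hil d := Q.derivCircuit k θ Q.input

theorem derivState_zero : Q.derivState 0 = Q.state := by
  ext1 θ; rw [derivState, derivCircuit_zero, state]

theorem hasLineDerivAt_derivState (k : Fin M → ℕ) (θ : Fin M → ℝ) (ν : Fin M) :
    HasLineDerivAt ℝ (Q.derivState k) (Q.derivState (k + Pi.single ν 1) θ) θ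
      (Pi.single ν 1) := by
  have h := Q.hasLineDerivAt_derivCircuit k θ ν
  rw [HasLineDerivAt] at h ⊢
  exact ((ContinuousLinearMap.apply ℂ (Hil d) Q.input).restrictScalars ℝ).hasFDerivAt.comp_hasDerivAt
    0 h

theorem norm_derivState_le [NeZero d] (k : Fin M → ℕ) (θ : Fin M → ℝ) :
    ‖Q.derivState k θ‖ ≤ ∏ μ, ‖Q.generator μ‖ ^ k μ := by
  refine ((Q.derivCircuit k θ).le_opNorm _).trans ?_
  rw [Q.input_norm, mul_one]
  exact Q.norm_derivCircuit_le k θ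

theorem norm_derivState_single_le [NeZero d] (θ : Fin M → ℝ) (ν : Fin M) :
    ‖Q.derivState (Pi.single ν 1) θ‖ ≤ ‖Q.generator ν‖ := by
  refine (Q.norm_derivState_le _ θ).trans_eq ?_
  rw [Finset.prod_eq_single ν] <;> simp +contextual

theorem norm_derivState_single_add_single_le [NeZero d] (θ : Fin M → ℝ) (ν μ : Fin M) :
    ‖Q.derivState (Pi.single ν 1 + Pi.single μ 1) θ‖ ≤ ‖Q.generator ν‖ * ‖Q.generator μ‖ := by
  refine (Q.norm_derivState_le _ θ).trans_eq ?_
  simp only [Pi.add_apply, pow_add, Finset.prod_mul_distrib]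
  congr 1
  · rw [Finset.prod_eq_single ν] <;> simp +contextual
  · rw [Finset.prod_eq_single μ] <;> simp +contextual

theorem norm_state (θ : Fin M → ℝ) : ‖Q.state θ‖ = 1 := by
  have h : Q.circuit θ ∈ unitary (Op d) := by
    refine list_prod_mem fun x hx => ?_
    rw [List.mem_reverse, List.mem_ofFn] at hx
    obtain ⟨μ, rfl⟩ := hx
    exact Q.layer_mem_unitary μ _
  rw [state, ContinuousLinearMap.norm_map_of_mem_unitary h, Q.input_norm]

theorem partialD_state (μ : Fin M) (θ : Fin M → ℝ) :
    partialD μ Q.state θ = Q.derivState (Pi.single μ 1) θ := by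
  have h := Q.hasLineDerivAt_derivState 0 θ μ
  rw [zero_add, derivState_zero] at h
  exact h.lineDeriv

/-- Product rule for sesquilinear expressions in the derivatives of the state. -/
theorem partialD_re_inner (A : Op d) (k l : Fin M → ℕ) (μ : Fin M) (θ : Fin M → ℝ) :
    partialD μ (fun θ => (inner ℂ (Q.derivState k θ) (A (Q.derivState l θ))).re) θ =
      (inner ℂ (Q.derivState (k + Pi.single μ 1) θ) (A (Q.derivState l θ))).re +
      (inner ℂ (Q.derivState k θ) (A (Q.derivState (l + Pi.single μ 1) θ))).re := by
  refine HasLineDerivAt.lineDeriv ?_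
  have hk := Q.hasLineDerivAt_derivState k θ μ
  have hl := Q.hasLineDerivAt_derivState l θ μ
  rw [HasLineDerivAt] at hk hl ⊢
  have hl' := (A.restrictScalars ℝ).hasFDerivAt.comp_hasDerivAt 0 hl
  have h := Complex.reCLM.hasFDerivAt.comp_hasDerivAt 0 (hk.inner ℂ hl')
  simp only [zero_smul, add_zero, Function.comp_apply, Complex.reCLM_apply, Complex.add_re] at h
  rw [add_comm]
  exact h

theorem _root_.re_inner_apply_comm_of_isSelfAdjoint {A : Op d} (hA : IsSelfAdjoint A) (x y : Hil d) :
    (inner ℂ x (A y)).re = (inner ℂ y (A x)).re := by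
  have h : inner ℂ (A x) y = inner ℂ x (A y) :=
    ContinuousLinearMap.isSelfAdjoint_iff_isSymmetric.mp hA x y
  rw [← h, ← inner_conj_symm]
  rfl

theorem partialD_energyLoss {A : Op d} (hA : IsSelfAdjoint A) (ν : Fin M) (θ : Fin M → ℝ) :
    partialD ν (Q.energyLoss A) θ =
      2 * (inner ℂ (Q.derivState (Pi.single ν 1) θ) (A (Q.derivState 0 θ))).re := by
  have h := Q.partialD_re_inner A 0 0 ν θ
  rw [zero_add, re_inner_apply_comm_of_isSelfAdjoint hA (Q.derivState 0 θ)] at h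
  rw [two_mul, ← h, derivState_zero]
  rfl

theorem partialD_const_mul {f : (Fin M → ℝ) → ℝ} (c : ℝ) (μ : Fin M) (θ : Fin M → ℝ) :
    partialD μ (fun θ => c * f θ) θ = c * partialD μ f θ := by
  simp only [partialD, lineDeriv]
  exact deriv_const_mul_field c

theorem hessianMatrix_energyLoss {A : Op d} (hA : IsSelfAdjoint A) (θ : Fin M → ℝ)
    (μ ν : Fin M) :
    hessianMatrix (Q.energyLoss A) θ μ ν =
      2 * (inner ℂ (Q.derivState (Pi.single ν 1 + Pi.single μ 1) θ) (A (Q.state θ))).re +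
      2 * (inner ℂ (Q.derivState (Pi.single ν 1) θ) (A (Q.derivState (Pi.single μ 1) θ))).re := by
  rw [hessianMatrix, Matrix.of_apply, funext fun θ => Q.partialD_energyLoss hA ν θ,
    partialD_const_mul, partialD_re_inner, zero_add, derivState_zero]
  ring

/-- Differentiates `‖ψ‖² = 1`, seen as the loss of the observable `1`. -/
theorem re_inner_derivState_state (ν : Fin M) (θ : Fin M → ℝ) :
    (inner ℂ (Q.derivState (Pi.single ν 1) θ) (Q.state θ)).re = 0 := by
  have h := Q.partialD_energyLoss (IsSelfAdjoint.one (Op d)) ν θ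
  have h1 : Q.energyLoss 1 = fun _ => 1 := by
    ext θ
    simp [energyLoss, Op.avg, norm_state, inner_self_eq_norm_sq_to_K]
  rw [h1, derivState_zero] at h
  simp [partialD, lineDeriv] at h
  simpa using h

/-- Second derivative of `‖ψ‖² = 1`. It trades the second-derivative term of the Hessian along `ψ`
for the Gram matrix of first derivatives, from which the Fisher matrix emerges. -/
theorem re_inner_derivState_derivState (μ ν : Fin M) (θ : Fin M → ℝ) :
    (inner ℂ (Q.derivState (Pi.single ν 1 + Pi.single μ 1) θ) (Q.state θ)).re =
      -(inner ℂ (Q.derivState (Pi.single ν 1) θ) (Q.derivState (Pi.single μ 1) θ)).re := by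
  have h := Q.partialD_re_inner 1 (Pi.single ν 1) 0 μ θ
  have h1 : (fun θ => (inner ℂ (Q.derivState (Pi.single ν 1) θ)
      ((1 : Op d) (Q.derivState 0 θ))).re) = fun _ => 0 := by
    ext θ
    simpa [derivState_zero] using Q.re_inner_derivState_state ν θ
  rw [h1, derivState_zero] at h
  simp [partialD, lineDeriv] at h
  linarith

end QNN

/-! ### Second and fourth moments of Haar unitaries -/

section HaarMoments

variable {K : Type*} [NormedAddCommGroup K] [InnerProductSpace ℂ K]

theorem exists_orthonormalBasis_mem [FiniteDimensional ℂ K] {k : K} (hk : ‖k‖ = 1) :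
    ∃ (b : OrthonormalBasis (Fin (Module.finrank ℂ K)) ℂ K) (i : _), b i = k := by
  have hpos : 0 < Module.finrank ℂ K := by
    have : Nontrivial K := ⟨k, 0, by rintro rfl; simp at hk⟩
    exact Module.finrank_pos
  obtain ⟨b, hb⟩ := Orthonormal.exists_orthonormalBasis_extension_of_card_eq (𝕜 := ℂ) (E := K)
    (ι := Fin (Module.finrank ℂ K)) (by simp) (v := fun _ => k) (s := {⟨0, hpos⟩}) (by
      rw [orthonormal_subsingleton_iff]
      intro i
      simpa using hk)
  exact ⟨b, ⟨0, hpos⟩, hb _ rfl⟩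

variable [CompleteSpace K]

theorem inner_unitary_mul_apply (g u : UnitaryOps K) (x k : K) :
    inner ℂ (((g * u : UnitaryOps K) : K →L[ℂ] K) x) ((g : K →L[ℂ] K) k) =
      inner ℂ ((u : K →L[ℂ] K) x) k := by
  exact ContinuousLinearMap.inner_map_map_of_mem_unitary g.2 _ _

@[fun_prop]
theorem continuous_unitary_apply (x : K) :
    Continuous fun u : UnitaryOps K => (u : K →L[ℂ] K) x :=
  continuous_subtype_val.clm_apply continuous_const

theorem exists_unitary_apply_basis {ι : Type*} [Fintype ι] (b b' : OrthonormalBasis ι ℂ K)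
    (e : ι ≃ ι) : ∃ g : UnitaryOps K, ∀ i, (g : K →L[ℂ] K) (b i) = b' (e i) := by
  refine ⟨Unitary.linearIsometryEquiv.symm (b.equiv b' e), fun i => ?_⟩
  exact b.equiv_apply_basis b' e i

theorem norm_unitary_apply (u : UnitaryOps K) (x : K) : ‖(u : K →L[ℂ] K) x‖ = ‖x‖ :=
  ContinuousLinearMap.norm_map_of_mem_unitary u.2 x

variable [FiniteDimensional ℂ K]

theorem exists_unitary_apply_eq {k k' : K} (hk : ‖k‖ = 1) (hk' : ‖k'‖ = 1) :
    ∃ g : UnitaryOps K, (g : K →L[ℂ] K) k = k' := by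
  obtain ⟨b, i, rfl⟩ := exists_orthonormalBasis_mem hk
  obtain ⟨b', i', rfl⟩ := exists_orthonormalBasis_mem hk'
  obtain ⟨g, hg⟩ := exists_unitary_apply_basis b b' (Equiv.swap i i')
  exact ⟨g, by simp [hg]⟩

instance haarUnitary_isProbabilityMeasure : IsProbabilityMeasure (haarUnitary K) :=
  ⟨by
    have h := Measure.haarMeasure_self (K₀ := (⊤ : TopologicalSpace.PositiveCompacts (UnitaryOps K)))
    simpa [haarUnitary] using h⟩

instance haarUnitary_isMulLeftInvariant : (haarUnitary K).IsMulLeftInvariant := by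
  unfold haarUnitary; infer_instance

theorem Continuous.integrable_haarUnitary {f : UnitaryOps K → ℝ} (hf : Continuous f) :
    Integrable f (haarUnitary K) :=
  hf.integrable_of_hasCompactSupport (HasCompactSupport.of_compactSpace f)

/-- The Haar integral of a function of `⟨u x, k⟩` does not depend on the unit vector `k`. -/
theorem integral_haarUnitary_comp_inner (F : ℂ → ℝ) (x : K) {k k' : K} (hk : ‖k‖ = 1)
    (hk' : ‖k'‖ = 1) :
    ∫ u, F (inner ℂ ((u : K →L[ℂ] K) x) k) ∂haarUnitary K =
      ∫ u, F (inner ℂ ((u : K →L[ℂ] K) x) k') ∂haarUnitary K := by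
  obtain ⟨g, rfl⟩ := exists_unitary_apply_eq hk hk'
  symm
  rw [← integral_mul_left_eq_self _ g]
  exact integral_congr_ae (ae_of_all _ fun u => by simp only [inner_unitary_mul_apply])

/-- All coordinates of `u x` in an orthonormal basis have the same second moment, and the squares
sum to `‖x‖²`. -/
theorem integral_haarUnitary_norm_inner_sq_of_unit (x : K) {k : K} (hk : ‖k‖ = 1) :
    Module.finrank ℂ K * ∫ u, ‖inner ℂ ((u : K →L[ℂ] K) x) k‖ ^ 2 ∂haarUnitary K = ‖x‖ ^ 2 := by
  let b := stdOrthonormalBasis ℂ K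
  have h1 : ∑ i, ∫ u, ‖inner ℂ ((u : K →L[ℂ] K) x) (b i)‖ ^ 2 ∂haarUnitary K = ‖x‖ ^ 2 := by
    rw [← integral_finsetSum]
    · simp [b.sum_sq_norm_inner_left, norm_unitary_apply]
    · intro i _
      exact Continuous.integrable_haarUnitary (by fun_prop)
  rw [← h1, Finset.sum_congr rfl fun i _ =>
    integral_haarUnitary_comp_inner (fun z => ‖z‖ ^ 2) x (b.norm_eq_one i) hk]
  simp

theorem integral_haarUnitary_norm_inner_sq (x k : K) :
    Module.finrank ℂ K * ∫ u, ‖inner ℂ ((u : K →L[ℂ] K) x) k‖ ^ 2 ∂haarUnitary K =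
      ‖x‖ ^ 2 * ‖k‖ ^ 2 := by
  rcases eq_or_ne k 0 with rfl | hk
  · simp
  have h0 : (‖k‖ : ℂ) ≠ 0 := by simpa using hk
  have hu : ‖((‖k‖ : ℂ)⁻¹) • k‖ = 1 := by
    rw [norm_smul]; simp [hk]
  have hk2 : k = (‖k‖ : ℂ) • (((‖k‖ : ℂ)⁻¹) • k) := by
    rw [smul_smul, mul_inv_cancel₀ h0, one_smul]
  have h := integral_haarUnitary_norm_inner_sq_of_unit x hu
  rw [← h]
  conv_lhs => rw [hk2]
  simp only [inner_smul_right _ _ (‖k‖ : ℂ), norm_mul, mul_pow, integral_const_mul]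
  simp only [Complex.norm_real, norm_norm]
  ring

/-- The real part of `⟨u x, k⟩` carries half of its second moment. -/
theorem integral_haarUnitary_re_inner_sq (x k : K) :
    Module.finrank ℂ K * ∫ u, (inner ℂ ((u : K →L[ℂ] K) x) k).re ^ 2 ∂haarUnitary K =
      ‖x‖ ^ 2 * ‖k‖ ^ 2 / 2 := by
  -- Left translation by the unitary `i` exchanges real and imaginary parts up to sign, so both have
  -- the same second moment.
  have hI : Complex.I • (1 : K →L[ℂ] K) ∈ unitary (K →L[ℂ] K) := by
    rw [Unitary.mem_iff]
    constructor <;> simp [star_smul, smul_smul]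
  have h1 : ∫ u, (inner ℂ ((u : K →L[ℂ] K) x) k).im ^ 2 ∂haarUnitary K =
      ∫ u, (inner ℂ ((u : K →L[ℂ] K) x) k).re ^ 2 ∂haarUnitary K := by
    rw [← integral_mul_left_eq_self (μ := haarUnitary K)
      (fun u => (inner ℂ ((u : K →L[ℂ] K) x) k).re ^ 2) ⟨_, hI⟩]
    refine integral_congr_ae (ae_of_all _ fun u => ?_)
    simp
  have h2 := integral_haarUnitary_norm_inner_sq x k
  have h3 : ∫ u, ‖inner ℂ ((u : K →L[ℂ] K) x) k‖ ^ 2 ∂haarUnitary K =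
      ∫ u, (inner ℂ ((u : K →L[ℂ] K) x) k).re ^ 2 ∂haarUnitary K +
      ∫ u, (inner ℂ ((u : K →L[ℂ] K) x) k).im ^ 2 ∂haarUnitary K := by
    rw [← integral_add]
    · refine integral_congr_ae (ae_of_all _ fun u => ?_)
      simp only [← Complex.normSq_eq_norm_sq, Complex.normSq_apply]
      ring
    · exact Continuous.integrable_haarUnitary
        ((Complex.continuous_re.comp (by fun_prop)).pow 2)
    · exact Continuous.integrable_haarUnitary
        ((Complex.continuous_im.comp (by fun_prop)).pow 2)
  rw [h3, h1] at h2
  linarith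

/-- The two sides differ by `8 (Im (z w̄))²`, the square supplied to `nlinarith`. -/
theorem Complex.norm_add_pow_four_add_norm_sub_pow_four_le (z w : ℂ) :
    ‖z + w‖ ^ 4 + ‖z - w‖ ^ 4 ≤ 2 * ‖z‖ ^ 4 + 2 * ‖w‖ ^ 4 + 12 * (‖z‖ ^ 2 * ‖w‖ ^ 2) := by
  have e : ∀ v : ℂ, ‖v‖ ^ 4 = Complex.normSq v ^ 2 := fun v => by
    rw [Complex.normSq_eq_norm_sq]; ring
  simp only [e, ← Complex.normSq_eq_norm_sq, Complex.normSq_apply, Complex.add_re, Complex.add_im,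
    Complex.sub_re, Complex.sub_im]
  nlinarith [sq_nonneg (z.re * w.im - z.im * w.re)]

/-- A fourth moment bound for the coordinates of a Haar random vector. -/
theorem integral_haarUnitary_norm_inner_pow_four_le (x : K) {k : K} (hk : ‖k‖ = 1) :
    Module.finrank ℂ K * (Module.finrank ℂ K + 2) *
      ∫ u, ‖inner ℂ ((u : K →L[ℂ] K) x) k‖ ^ 4 ∂haarUnitary K ≤ 3 * ‖x‖ ^ 4 := by
  let b := stdOrthonormalBasis ℂ K
  set A := ∫ u, ‖inner ℂ ((u : K →L[ℂ] K) x) k‖ ^ 4 ∂haarUnitary K with hA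
  let B : Fin (Module.finrank ℂ K) → Fin (Module.finrank ℂ K) → ℝ := fun i j =>
    ∫ u, ‖inner ℂ ((u : K →L[ℂ] K) x) (b i)‖ ^ 2 * ‖inner ℂ ((u : K →L[ℂ] K) x) (b j)‖ ^ 2
      ∂haarUnitary K
  have hunit : ∀ k' : K, ‖k'‖ = 1 →
      ∫ u, ‖inner ℂ ((u : K →L[ℂ] K) x) k'‖ ^ 4 ∂haarUnitary K = A := fun k' hk' =>
    integral_haarUnitary_comp_inner (fun z => ‖z‖ ^ 4) x hk' hk
  have hsqrt : ∀ k' : K, ‖k'‖ ^ 2 = 2 →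
      ∫ u, ‖inner ℂ ((u : K →L[ℂ] K) x) k'‖ ^ 4 ∂haarUnitary K = 4 * A := by
    intro k' hk'
    have h4 : ‖k'‖ ^ 4 = 4 := by nlinarith
    have h0 : ‖k'‖ ≠ 0 := by intro h; simp [h] at hk'
    have h0' : (‖k'‖ : ℂ) ≠ 0 := by exact_mod_cast h0
    have hu : ‖((‖k'‖ : ℂ)⁻¹) • k'‖ = 1 := by
      rw [norm_smul]; simp [h0]
    have hk2 : k' = (‖k'‖ : ℂ) • (((‖k'‖ : ℂ)⁻¹) • k') := by
      rw [smul_smul, mul_inv_cancel₀ h0', one_smul]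
    rw [← hunit _ hu]
    conv_lhs => rw [hk2]
    simp only [inner_smul_right _ _ (‖k'‖ : ℂ), norm_mul, mul_pow, integral_const_mul]
    simp only [Complex.norm_real, norm_norm, h4]
  have hdiag : ∀ i, B i i = A := fun i => by
    rw [← hunit (b i) (b.norm_eq_one i)]
    refine integral_congr_ae (ae_of_all _ fun u => ?_)
    ring
  -- The vectors `b i ± b j` have squared norm `2`, hence fourth moment `4 A` each. Integrating the
  -- polarization inequality gives `8 A ≤ 4 A + 12 B i j`.
  have hoff : ∀ i j, i ≠ j → A ≤ 3 * B i j := by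
    intro i j hij
    have hin : inner ℂ (b i) (b j) = 0 := b.orthonormal.2 hij
    have hp : ‖b i + b j‖ ^ 2 = 2 := by
      rw [sq, norm_add_sq_eq_norm_sq_add_norm_sq_of_inner_eq_zero _ _ hin]
      simp; norm_num
    have hm : ‖b i - b j‖ ^ 2 = 2 := by
      rw [sub_eq_add_neg, sq, norm_add_sq_eq_norm_sq_add_norm_sq_of_inner_eq_zero (𝕜 := ℂ) _ _ (by simp [hin])]
      simp; norm_num
    have hle : ∫ u, (‖inner ℂ ((u : K →L[ℂ] K) x) (b i + b j)‖ ^ 4 +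
          ‖inner ℂ ((u : K →L[ℂ] K) x) (b i - b j)‖ ^ 4) ∂haarUnitary K ≤
        ∫ u, (2 * ‖inner ℂ ((u : K →L[ℂ] K) x) (b i)‖ ^ 4 +
          2 * ‖inner ℂ ((u : K →L[ℂ] K) x) (b j)‖ ^ 4 +
          12 * (‖inner ℂ ((u : K →L[ℂ] K) x) (b i)‖ ^ 2 *
            ‖inner ℂ ((u : K →L[ℂ] K) x) (b j)‖ ^ 2)) ∂haarUnitary K := by
      refine integral_mono ?_ ?_ fun u => ?_
      · exact Continuous.integrable_haarUnitary (by fun_prop)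
      · exact Continuous.integrable_haarUnitary (by fun_prop)
      · simp only [inner_add_right, inner_sub_right]
        exact Complex.norm_add_pow_four_add_norm_sub_pow_four_le _ _
    rw [integral_add, integral_add, integral_add, integral_const_mul, integral_const_mul,
      integral_const_mul, hsqrt _ hp, hsqrt _ hm, hunit _ (b.norm_eq_one i),
      hunit _ (b.norm_eq_one j)] at hle
    · change _ ≤ _ + _ + 12 * B i j at hle
      linarith
    all_goals exact Continuous.integrable_haarUnitary (by fun_prop)
  have hsum : ∑ i, ∑ j, B i j = ‖x‖ ^ 4 := by
    simp only [B]
    rw [Finset.sum_congr rfl fun i _ => (integral_finsetSum Finset.univ fun j _ =>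
      Continuous.integrable_haarUnitary (by fun_prop)).symm, ← integral_finsetSum]
    · simp only [← Finset.mul_sum, ← Finset.sum_mul, b.sum_sq_norm_inner_left, norm_unitary_apply]
      simp; ring
    · intro i _
      exact Continuous.integrable_haarUnitary (by fun_prop)
  have hrow : ∀ i, A + (Module.finrank ℂ K - 1) * (A / 3) ≤ ∑ j, B i j := by
    intro i
    rw [← Finset.add_sum_erase _ _ (Finset.mem_univ i), hdiag]
    gcongr
    calc ((Module.finrank ℂ K : ℝ) - 1) * (A / 3) =
        ∑ _j ∈ Finset.univ.erase i, A / 3 := by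
          have : 1 ≤ Module.finrank ℂ K := Nat.one_le_iff_ne_zero.mpr fun h => by
            rw [h] at i; exact i.elim0
          rw [Finset.sum_const, Finset.card_erase_of_mem (Finset.mem_univ i)]
          simp [Nat.cast_sub this]
      _ ≤ _ := Finset.sum_le_sum fun j hj => by
          have := hoff i j (Finset.ne_of_mem_erase hj).symm
          linarith
  -- With `D` the dimension, summing the rows gives `D (A + (D - 1) A / 3) ≤ ‖x‖⁴`, which is the
  -- claim after multiplying by `3`.
  have := Finset.sum_le_sum fun i (_ : i ∈ Finset.univ) => hrow i
  rw [hsum] at this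
  simp only [Finset.sum_const, Finset.card_univ, Fintype.card_fin, nsmul_eq_mul] at this
  linarith

/-- AM-GM with the weights `‖y‖⁴` and `‖x‖⁴`, which keep the bound homogeneous in both vectors,
reduces the mixed moment to fourth moments. -/
theorem integral_haarUnitary_norm_inner_sq_mul_le (x y : K) {k : K} (hk : ‖k‖ = 1) :
    Module.finrank ℂ K * (Module.finrank ℂ K + 2) *
      ∫ u, ‖inner ℂ ((u : K →L[ℂ] K) x) k‖ ^ 2 * ‖inner ℂ ((u : K →L[ℂ] K) y) k‖ ^ 2
        ∂haarUnitary K ≤ 3 * (‖x‖ ^ 2 * ‖y‖ ^ 2) := by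
  rcases eq_or_ne x 0 with rfl | hx
  · simp
  rcases eq_or_ne y 0 with rfl | hy
  · simp
  have hX : 0 < ‖x‖ ^ 2 := by positivity
  have hY : 0 < ‖y‖ ^ 2 := by positivity
  have hint : ∫ u, 2 * (‖x‖ ^ 2 * ‖y‖ ^ 2) * (‖inner ℂ ((u : K →L[ℂ] K) x) k‖ ^ 2 *
        ‖inner ℂ ((u : K →L[ℂ] K) y) k‖ ^ 2) ∂haarUnitary K ≤
      ∫ u, (‖y‖ ^ 4 * ‖inner ℂ ((u : K →L[ℂ] K) x) k‖ ^ 4 +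
        ‖x‖ ^ 4 * ‖inner ℂ ((u : K →L[ℂ] K) y) k‖ ^ 4) ∂haarUnitary K := by
    refine integral_mono ?_ ?_ fun u => ?_
    · exact Continuous.integrable_haarUnitary (by fun_prop)
    · exact Continuous.integrable_haarUnitary (by fun_prop)
    · have := two_mul_le_add_sq (‖y‖ ^ 2 * ‖inner ℂ ((u : K →L[ℂ] K) x) k‖ ^ 2)
        (‖x‖ ^ 2 * ‖inner ℂ ((u : K →L[ℂ] K) y) k‖ ^ 2)
      calc _ = _ := by ring
        _ ≤ _ := this
        _ = _ := by ring
  rw [integral_const_mul, integral_add, integral_const_mul, integral_const_mul] at hint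
  · have h1 := integral_haarUnitary_norm_inner_pow_four_le x hk
    have h2 := integral_haarUnitary_norm_inner_pow_four_le y hk
    set n : ℝ := Module.finrank ℂ K * (Module.finrank ℂ K + 2)
    have hn : 0 ≤ n := by positivity
    refine le_of_mul_le_mul_left ?_ (mul_pos hX hY)
    have h3 := mul_le_mul_of_nonneg_left hint hn
    have h4 := mul_le_mul_of_nonneg_left h1 (by positivity : 0 ≤ ‖y‖ ^ 4)
    have h5 := mul_le_mul_of_nonneg_left h2 (by positivity : 0 ≤ ‖x‖ ^ 4)
    linarith
  all_goals exact Continuous.integrable_haarUnitary (by fun_prop)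

theorem Equiv.Perm.exists_apply_eq_apply_eq {ι : Type*} [DecidableEq ι] {k l k' l' : ι}
    (h : k ≠ l) (h' : k' ≠ l') : ∃ σ : Equiv.Perm ι, σ k = k' ∧ σ l = l' := by
  refine ⟨Equiv.swap (Equiv.swap k k' l) l' * Equiv.swap k k', ?_, ?_⟩
  · rw [Equiv.Perm.mul_apply, Equiv.swap_apply_left]
    refine Equiv.swap_apply_of_ne_of_ne ?_ h'
    intro e
    have := congrArg (Equiv.swap k k') e
    rw [Equiv.swap_apply_right, Equiv.swap_apply_self] at this
    exact h this
  · simp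

theorem Complex.norm_sum_sq {ι : Type*} (s : Finset ι) (z : ι → ℂ) :
    ‖∑ i ∈ s, z i‖ ^ 2 = ∑ i ∈ s, ∑ j ∈ s, (z i * (starRingEnd ℂ) (z j)).re := by
  have h : ((‖∑ i ∈ s, z i‖ ^ 2 : ℝ) : ℂ) = ∑ i ∈ s, ∑ j ∈ s, z i * (starRingEnd ℂ) (z j) := by
    rw [Complex.ofReal_pow, ← Complex.mul_conj', map_sum, Finset.sum_mul_sum]
  rw [← Complex.ofReal_re (‖∑ i ∈ s, z i‖ ^ 2), h]
  simp only [Complex.re_sum]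

/-- The variance of a matrix element of a Haar random conjugate of a traceless self-adjoint
operator with eigenbasis `b` and eigenvalues `lam`. -/
theorem integral_haarUnitary_norm_sum_sq_le (x y : K) (hK : 2 ≤ Module.finrank ℂ K)
    (b : OrthonormalBasis (Fin (Module.finrank ℂ K)) ℂ K) (lam : Fin (Module.finrank ℂ K) → ℝ)
    (hlam : ∑ i, lam i = 0) :
    ((Module.finrank ℂ K : ℝ) - 1) * (Module.finrank ℂ K + 2) *
      ∫ u, ‖∑ i, (lam i : ℂ) * (inner ℂ ((u : K →L[ℂ] K) x) (b i) *
        inner ℂ (b i) ((u : K →L[ℂ] K) y))‖ ^ 2 ∂haarUnitary K ≤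
      3 * (‖x‖ ^ 2 * ‖y‖ ^ 2) * ∑ i, lam i ^ 2 := by
  let z : Fin (Module.finrank ℂ K) → UnitaryOps K → ℂ := fun i u =>
    inner ℂ ((u : K →L[ℂ] K) x) (b i) * inner ℂ (b i) ((u : K →L[ℂ] K) y)
  have hz : ∀ i, Continuous (z i) := fun i => by fun_prop
  let g : Fin (Module.finrank ℂ K) → Fin (Module.finrank ℂ K) → ℝ := fun i j =>
    ∫ u, (z i u * (starRingEnd ℂ) (z j u)).re ∂haarUnitary K
  have hcont : ∀ i j, Continuous fun u => (z i u * (starRingEnd ℂ) (z j u)).re := fun i j =>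
    Complex.continuous_re.comp ((hz i).mul (Complex.continuous_conj.comp (hz j)))
  -- Permuting the basis is unitary, so left invariance makes `g` invariant under simultaneous
  -- permutation of its indices. By double transitivity it has one diagonal and one off-diagonal
  -- value.
  have hperm : ∀ (σ : Equiv.Perm (Fin (Module.finrank ℂ K))) i j, g (σ i) (σ j) = g i j := by
    intro σ i j
    obtain ⟨v, hv⟩ := exists_unitary_apply_basis b b σ
    have key : ∀ i u, z (σ i) (v * u) = z i u := fun i u => by
      simp only [z, ← hv]
      rw [inner_unitary_mul_apply, ← inner_conj_symm ((v : K →L[ℂ] K) (b i)),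
        inner_unitary_mul_apply, inner_conj_symm]
    simp only [g]
    rw [← integral_mul_left_eq_self _ v]
    simp only [key]
  let i₀ : Fin (Module.finrank ℂ K) := ⟨0, by omega⟩
  let i₁ : Fin (Module.finrank ℂ K) := ⟨1, by omega⟩
  have h01 : i₀ ≠ i₁ := by simp [i₀, i₁]
  have hdiag : ∀ i, g i i = g i₀ i₀ := fun i => by
    rw [← hperm (Equiv.swap i i₀) i i, Equiv.swap_apply_left]
  have hoff : ∀ i j, i ≠ j → g i j = g i₀ i₁ := fun i j hij => by
    obtain ⟨σ, h0, h1⟩ := Equiv.Perm.exists_apply_eq_apply_eq hij h01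
    rw [← hperm σ i j, h0, h1]
  have hg : ∀ i j, g i j = g i₀ i₁ + if i = j then g i₀ i₀ - g i₀ i₁ else 0 := by
    intro i j
    split_ifs with h
    · subst h; rw [hdiag]; ring
    · rw [hoff i j h, add_zero]
  have hexp : ∀ c : Fin (Module.finrank ℂ K) → ℝ,
      ∫ u, ‖∑ i, (c i : ℂ) * z i u‖ ^ 2 ∂haarUnitary K =
        g i₀ i₁ * (∑ i, c i) ^ 2 + (g i₀ i₀ - g i₀ i₁) * ∑ i, c i ^ 2 := by
    intro c
    have e1 : ∀ u, ‖∑ i, (c i : ℂ) * z i u‖ ^ 2 =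
        ∑ i, ∑ j, c i * c j * (z i u * (starRingEnd ℂ) (z j u)).re := by
      intro u
      rw [Complex.norm_sum_sq]
      refine Finset.sum_congr rfl fun i _ => Finset.sum_congr rfl fun j _ => ?_
      rw [map_mul, Complex.conj_ofReal, mul_mul_mul_comm, ← Complex.ofReal_mul,
        Complex.re_ofReal_mul]
    simp only [e1]
    rw [integral_finsetSum]
    · have e2 : ∀ i, ∫ u, ∑ j, c i * c j * (z i u * (starRingEnd ℂ) (z j u)).re ∂haarUnitary K =
          ∑ j, c i * c j * g i j := by
        intro i
        rw [integral_finsetSum]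
        · simp only [integral_const_mul, g]
        · exact fun j _ => ((hcont i j).const_mul _).integrable_haarUnitary
      rw [Finset.sum_congr rfl fun i _ => (e2 i).trans (Finset.sum_congr rfl fun j _ => by rw [hg])]
      simp only [mul_add, mul_ite, mul_zero, Finset.sum_add_distrib, Finset.sum_ite_eq,
        Finset.mem_univ, if_true]
      congr 1
      · rw [sq, Finset.sum_mul_sum, Finset.mul_sum]
        refine Finset.sum_congr rfl fun i _ => ?_
        rw [Finset.mul_sum]
        exact Finset.sum_congr rfl fun j _ => by ring
      · rw [Finset.mul_sum]
        exact Finset.sum_congr rfl fun j _ => by ring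
    · exact fun i _ => (continuous_finsetSum _ fun j _ =>
        (hcont i j).const_mul _).integrable_haarUnitary
  have hb : Module.finrank ℂ K * (Module.finrank ℂ K + 2) * g i₀ i₀ ≤
      3 * (‖x‖ ^ 2 * ‖y‖ ^ 2) := by
    convert integral_haarUnitary_norm_inner_sq_mul_le x y (b.norm_eq_one i₀) using 2
    refine integral_congr_ae (ae_of_all _ fun u => ?_)
    simp only [z]
    rw [Complex.mul_conj, Complex.ofReal_re, Complex.normSq_eq_norm_sq, norm_mul, mul_pow,
      norm_inner_symm (b i₀)]
  -- Constant coefficients give a nonnegative integral, which bounds the off-diagonal value from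
  -- below: `(D - 1) g i₀ i₁ + g i₀ i₀ ≥ 0`. For `lam` itself the term with `(∑ lam)²` vanishes and
  -- only `g i₀ i₀ - g i₀ i₁` is left.
  have hone := hexp fun _ => 1
  have hnn : 0 ≤ ∫ u, ‖∑ i, ((1 : ℝ) : ℂ) * z i u‖ ^ 2 ∂haarUnitary K :=
    integral_nonneg fun u => by positivity
  rw [hone] at hnn
  have hlamz := hexp lam
  simp only [z] at hlamz
  rw [hlamz, hlam]
  simp only [Finset.sum_const, Finset.card_univ, Fintype.card_fin, nsmul_eq_mul] at hnn
  have hD : (2 : ℝ) ≤ Module.finrank ℂ K := by exact_mod_cast hK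
  have hS : 0 ≤ ∑ i, lam i ^ 2 := Finset.sum_nonneg fun i _ => sq_nonneg _
  set D : ℝ := (Module.finrank ℂ K : ℝ)
  have hnn' : 0 ≤ (D - 1) * g i₀ i₁ + g i₀ i₀ := by
    refine nonneg_of_mul_nonneg_right (b := (D - 1) * g i₀ i₁ + g i₀ i₀) (a := D) ?_ (by linarith)
    linarith
  have hmain : (D - 1) * (D + 2) * (g i₀ i₀ - g i₀ i₁) ≤ 3 * (‖x‖ ^ 2 * ‖y‖ ^ 2) := by
    have := mul_nonneg (by linarith : 0 ≤ D + 2) hnn'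
    linarith
  have := mul_le_mul_of_nonneg_right hmain hS
  linarith

end HaarMoments

/-! ### Second moment of a Hessian fluctuation -/

section Variance

variable {K : Type*} [NormedAddCommGroup K] [InnerProductSpace ℂ K]

theorem inner_apply_eq_sum_of_eigenbasis {ι : Type*} [Fintype ι] (b : OrthonormalBasis ι ℂ K)
    {T : K →L[ℂ] K} {lam : ι → ℝ} (hT : ∀ i, T (b i) = (lam i : ℂ) • b i) (v w : K) :
    inner ℂ v (T w) = ∑ i, (lam i : ℂ) * (inner ℂ v (b i) * inner ℂ (b i) w) := by
  conv_lhs => rw [← b.sum_repr w]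
  rw [map_sum, inner_sum]
  refine Finset.sum_congr rfl fun i _ => ?_
  rw [map_smul, hT, inner_smul_right, inner_smul_right, b.repr_apply_apply]
  ring

variable [CompleteSpace K] [FiniteDimensional ℂ K]

theorem integral_haarUnitary_fluctuation_sq_le (hK : 2 ≤ Module.finrank ℂ K)
    (b : OrthonormalBasis (Fin (Module.finrank ℂ K)) ℂ K) {T : K →L[ℂ] K}
    {lam : Fin (Module.finrank ℂ K) → ℝ} (hT : ∀ i, T (b i) = (lam i : ℂ) • b i) {m : ℝ}
    (hm : ∑ i, lam i = Module.finrank ℂ K * m) (w h x y : K) :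
    ∫ u, (2 * (inner ℂ ((u : K →L[ℂ] K) w) h).re +
        2 * ((inner ℂ ((u : K →L[ℂ] K) x) (T ((u : K →L[ℂ] K) y))).re - m * (inner ℂ x y).re)) ^ 2
        ∂haarUnitary K ≤
      32 * (‖w‖ ^ 2 / 9 * (‖h‖ ^ 2 / Module.finrank ℂ K) + ‖x‖ ^ 2 * ‖y‖ ^ 2 *
        (2 * (∑ i, lam i ^ 2) / ((Module.finrank ℂ K + 1) * (Module.finrank ℂ K - 1)))) := by
  let R : UnitaryOps K → ℝ := fun u =>
    ‖∑ i, ((lam i - m : ℝ) : ℂ) * (inner ℂ ((u : K →L[ℂ] K) x) (b i) *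
        inner ℂ (b i) ((u : K →L[ℂ] K) y))‖ ^ 2
  let L : UnitaryOps K → ℝ := fun u => (inner ℂ ((u : K →L[ℂ] K) w) h).re ^ 2
  have hR : Continuous R := by fun_prop
  have hL : Continuous L := (Complex.continuous_re.comp (by fun_prop)).pow 2
  have hle : ∀ u : UnitaryOps K, (2 * (inner ℂ ((u : K →L[ℂ] K) w) h).re +
        2 * ((inner ℂ ((u : K →L[ℂ] K) x) (T ((u : K →L[ℂ] K) y))).re
          - m * (inner ℂ x y).re)) ^ 2 ≤ 64 / 9 * L u + 64 / 7 * R u := by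
    intro u
    have e : (inner ℂ ((u : K →L[ℂ] K) x) (T ((u : K →L[ℂ] K) y))).re - m * (inner ℂ x y).re =
        (∑ i, ((lam i - m : ℝ) : ℂ) * (inner ℂ ((u : K →L[ℂ] K) x) (b i) *
        inner ℂ (b i) ((u : K →L[ℂ] K) y))).re := by
      rw [inner_apply_eq_sum_of_eigenbasis b hT,
        ← ContinuousLinearMap.inner_map_map_of_mem_unitary u.2 x y,
        ← b.sum_inner_mul_inner ((u : K →L[ℂ] K) x), ← Complex.re_ofReal_mul, Finset.mul_sum,
        ← Complex.sub_re, ← Finset.sum_sub_distrib]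
      congr 1
      refine Finset.sum_congr rfl fun i _ => ?_
      push_cast
      ring
    rw [e]
    set s := ∑ i, ((lam i - m : ℝ) : ℂ) * (inner ℂ ((u : K →L[ℂ] K) x) (b i) *
        inner ℂ (b i) ((u : K →L[ℂ] K) y)) with hs
    have h1 : s.re ^ 2 ≤ R u := by
      simp only [R, ← hs]
      rw [← sq_abs]
      exact pow_le_pow_left₀ (abs_nonneg _) (Complex.abs_re_le_norm s) 2
    simp only [L]
    -- Weighted Cauchy-Schwarz with `9/16 + 7/16 = 1`. The weight `64/9`, halved by the real-part
    -- moment, is exactly the `32/9` of the claim; the other term has slack, as `3 · 64/7 ≤ 64`.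
    nlinarith [sq_nonneg (7 * (inner ℂ ((u : K →L[ℂ] K) w) h).re - 9 * s.re)]
  have hcont : Continuous fun u : UnitaryOps K => (2 * (inner ℂ ((u : K →L[ℂ] K) w) h).re +
        2 * ((inner ℂ ((u : K →L[ℂ] K) x) (T ((u : K →L[ℂ] K) y))).re
          - m * (inner ℂ x y).re)) ^ 2 := by
    have h1 : Continuous fun u : UnitaryOps K => (inner ℂ ((u : K →L[ℂ] K) w) h).re :=
      Complex.continuous_re.comp (by fun_prop)
    have h2 : Continuous fun u : UnitaryOps K =>
        (inner ℂ ((u : K →L[ℂ] K) x) (T ((u : K →L[ℂ] K) y))).re :=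
      Complex.continuous_re.comp (by fun_prop)
    fun_prop
  have hint := integral_mono hcont.integrable_haarUnitary
    ((hL.const_mul (64 / 9)).add (hR.const_mul (64 / 7))).integrable_haarUnitary hle
  rw [integral_add' (hL.const_mul _).integrable_haarUnitary (hR.const_mul _).integrable_haarUnitary,
    integral_const_mul, integral_const_mul] at hint
  refine hint.trans ?_
  have hD : (2 : ℝ) ≤ Module.finrank ℂ K := by exact_mod_cast hK
  have hLi := integral_haarUnitary_re_inner_sq w h
  have hRi := integral_haarUnitary_norm_sum_sq_le x y hK b (fun i => lam i - m) (by
    simp [Finset.sum_sub_distrib, hm])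
  -- Centring at the mean can only decrease the sum of squares.
  have hS : ∑ i, (lam i - m) ^ 2 ≤ ∑ i, lam i ^ 2 := by
    have : ∑ i, (lam i - m) ^ 2 = ∑ i, lam i ^ 2 - Module.finrank ℂ K * m ^ 2 := by
      simp only [sub_sq, Finset.sum_add_distrib, Finset.sum_sub_distrib, ← Finset.sum_mul,
        ← Finset.mul_sum, hm]
      simp
      ring
    rw [this]
    nlinarith [sq_nonneg m]
  change (Module.finrank ℂ K : ℝ) * ∫ u, L u ∂haarUnitary K = _ at hLi
  change _ * ∫ u, R u ∂haarUnitary K ≤ _ at hRi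
  set D : ℝ := (Module.finrank ℂ K : ℝ)
  have hR0 : 0 ≤ ∫ u, R u ∂haarUnitary K := integral_nonneg fun u => by positivity
  have hL' : ∫ u, L u ∂haarUnitary K = ‖w‖ ^ 2 * (‖h‖ ^ 2 / D) / 2 := by
    field_simp
    linarith
  have hR' : ∫ u, R u ∂haarUnitary K ≤
      3 * (‖x‖ ^ 2 * ‖y‖ ^ 2 * ((∑ i, lam i ^ 2) / ((D + 1) * (D - 1)))) := by
    have hp : 0 < (D + 1) * (D - 1) := by nlinarith
    rw [← mul_div_assoc, ← mul_div_assoc, le_div_iff₀ hp]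
    have h1 := mul_le_mul_of_nonneg_left hS (by positivity : 0 ≤ 3 * (‖x‖ ^ 2 * ‖y‖ ^ 2))
    have h2 := mul_nonneg (by linarith : 0 ≤ D - 1) hR0
    linarith
  have hpos : 0 ≤ ‖x‖ ^ 2 * ‖y‖ ^ 2 * ((∑ i, lam i ^ 2) / ((D + 1) * (D - 1))) := by
    refine mul_nonneg (by positivity) (div_nonneg (Finset.sum_nonneg fun i _ => sq_nonneg _) ?_)
    nlinarith
  rw [hL', mul_div_assoc 2]
  linarith

end Variance

/-! ### Conjugation by the block-diagonal unitary -/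

section Block

variable {d : ℕ} {ψ : Hil d}

theorem eq_inner_smul_add_projection (hψ : ‖ψ‖ = 1) (φ : Hil d) :
    φ = inner ℂ ψ φ • ψ + ((orthCompl ψ).orthogonalProjectionOnto φ : Hil d) := by
  have h := (Submodule.span ℂ {ψ}).starProjection_add_starProjection_orthogonal φ
  rw [Submodule.starProjection_unit_singleton ℂ hψ] at h
  exact h.symm

theorem inner_orthCompl_right (x : orthCompl ψ) : inner ℂ ψ (x : Hil d) = 0 :=
  Submodule.mem_orthogonal_singleton_iff_inner_right.mp x.2

theorem inner_orthCompl_left (x : orthCompl ψ) : inner ℂ (x : Hil d) ψ = 0 :=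
  Submodule.mem_orthogonal_singleton_iff_inner_left.mp x.2

theorem inner_eq_mul_add_inner_projection (hψ : ‖ψ‖ = 1) (φ χ : Hil d) :
    inner ℂ φ χ = inner ℂ φ ψ * inner ℂ ψ χ +
      inner ℂ ((orthCompl ψ).orthogonalProjectionOnto φ)
        ((orthCompl ψ).orthogonalProjectionOnto χ) := by
  conv_lhs => rw [eq_inner_smul_add_projection hψ φ, eq_inner_smul_add_projection hψ χ]
  have h1 : inner ℂ ψ ψ = (1 : ℂ) := by rw [inner_self_eq_norm_sq_to_K, hψ]; simp
  simp only [inner_add_left, inner_add_right, inner_smul_left, inner_smul_right,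
    inner_orthCompl_left, inner_orthCompl_right, h1, Submodule.coe_inner, inner_conj_symm]
  ring

theorem blockUnitary_apply (hψ : ‖ψ‖ = 1) (u : UnitaryOps (orthCompl ψ)) (φ : Hil d) :
    blockUnitary ψ u φ = inner ℂ ψ φ • ψ +
      ((u : orthCompl ψ →L[ℂ] orthCompl ψ) ((orthCompl ψ).orthogonalProjectionOnto φ) : Hil d) := by
  have h := eq_inner_smul_add_projection hψ φ
  have h2 : φ - ((orthCompl ψ).orthogonalProjectionOnto φ : Hil d) = inner ℂ ψ φ • ψ :=
    sub_eq_of_eq_add h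
  rw [← h2]
  rfl

theorem blockUnitary_apply_self (hψ : ‖ψ‖ = 1) (u : UnitaryOps (orthCompl ψ)) :
    blockUnitary ψ u ψ = ψ := by
  have h0 : (orthCompl ψ).orthogonalProjectionOnto ψ = 0 :=
    Submodule.orthogonalProjectionOnto_orthogonalComplement_singleton_eq_zero ψ
  rw [blockUnitary_apply hψ, h0, inner_self_eq_norm_sq_to_K, hψ]
  simp

theorem inner_star_mul_mul_apply (V H : Op d) (φ χ : Hil d) :
    inner ℂ φ ((star V * H * V) χ) = inner ℂ (V φ) (H (V χ)) := by
  rw [ContinuousLinearMap.star_eq_adjoint]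
  exact ContinuousLinearMap.adjoint_inner_right V φ (H (V χ))

theorem isSelfAdjoint_star_mul_mul (V : Op d) {H : Op d} (hH : IsSelfAdjoint H) :
    IsSelfAdjoint (star V * H * V) := hH.conjugate' V

/-- The compression of `H` to the orthogonal complement of `ψ`. -/
noncomputable def compression (H : Op d) (ψ : Hil d) : orthCompl ψ →L[ℂ] orthCompl ψ :=
  (orthCompl ψ).orthogonalProjectionOnto ∘L H ∘L (orthCompl ψ).subtypeL

theorem inner_compression (H : Op d) (x y : orthCompl ψ) :
    inner ℂ x (compression H ψ y) = inner ℂ (x : Hil d) (H (y : Hil d)) :=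
  Submodule.inner_orthogonalProjectionOnto_eq_of_mem_left x _

theorem im_inner_apply_self {H : Op d} (hH : IsSelfAdjoint H) (φ : Hil d) :
    (inner ℂ φ (H φ)).im = 0 := by
  have h : inner ℂ (H φ) φ = inner ℂ φ (H φ) :=
    ContinuousLinearMap.isSelfAdjoint_iff_isSymmetric.mp hH φ φ
  rw [← inner_conj_symm] at h
  exact Complex.conj_eq_iff_im.mp h

theorem inner_apply_self_eq_avg {H : Op d} (hH : IsSelfAdjoint H) (φ : Hil d) :
    inner ℂ φ (H φ) = (H.avg φ : ℂ) :=
  Complex.ext (by simp [Op.avg]) (by simpa using im_inner_apply_self hH φ)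

theorem re_inner_block_apply_self (hψ : ‖ψ‖ = 1) {H : Op d} (hH : IsSelfAdjoint H)
    (u : UnitaryOps (orthCompl ψ)) (φ : Hil d) :
    (inner ℂ φ ((star (blockUnitary ψ u) * H * blockUnitary ψ u) ψ)).re =
      (inner ℂ φ ψ).re * H.avg ψ +
      (inner ℂ ((u : orthCompl ψ →L[ℂ] orthCompl ψ) ((orthCompl ψ).orthogonalProjectionOnto φ))
        ((orthCompl ψ).orthogonalProjectionOnto (H ψ))).re := by
  rw [inner_star_mul_mul_apply, blockUnitary_apply_self hψ, blockUnitary_apply hψ, inner_add_left,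
    inner_smul_left, inner_conj_symm, inner_apply_self_eq_avg hH, Complex.add_re,
    Complex.re_mul_ofReal, Submodule.inner_orthogonalProjectionOnto_eq_of_mem_left]

/-- Splits by degree in `u`. Since `H` is self-adjoint, the two cross terms have real parts that
merge into a single term `Re⟨u w, PHψ⟩`. -/
theorem re_inner_block_apply (hψ : ‖ψ‖ = 1) {H : Op d} (hH : IsSelfAdjoint H)
    (u : UnitaryOps (orthCompl ψ)) (φ χ : Hil d) :
    (inner ℂ φ ((star (blockUnitary ψ u) * H * blockUnitary ψ u) χ)).re =
      (inner ℂ φ ψ * inner ℂ ψ χ).re * H.avg ψ +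
      (inner ℂ ((u : orthCompl ψ →L[ℂ] orthCompl ψ)
          (inner ℂ φ ψ • (orthCompl ψ).orthogonalProjectionOnto χ +
            inner ℂ χ ψ • (orthCompl ψ).orthogonalProjectionOnto φ))
        ((orthCompl ψ).orthogonalProjectionOnto (H ψ))).re +
      (inner ℂ ((u : orthCompl ψ →L[ℂ] orthCompl ψ) ((orthCompl ψ).orthogonalProjectionOnto φ))
        (compression H ψ ((u : orthCompl ψ →L[ℂ] orthCompl ψ)
          ((orthCompl ψ).orthogonalProjectionOnto χ)))).re := by
  set x := (u : orthCompl ψ →L[ℂ] orthCompl ψ) ((orthCompl ψ).orthogonalProjectionOnto φ) with hx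
  set y := (u : orthCompl ψ →L[ℂ] orthCompl ψ) ((orthCompl ψ).orthogonalProjectionOnto χ) with hy
  have hsym : ∀ z w : Hil d, inner ℂ (H z) w = inner ℂ z (H w) :=
    ContinuousLinearMap.isSelfAdjoint_iff_isSymmetric.mp hH
  have hcross : (inner ℂ φ ψ * inner ℂ ψ (H (y : Hil d))).re =
      (inner ℂ ψ φ * inner ℂ (y : Hil d) (H ψ)).re := by
    rw [← Complex.conj_re, map_mul, inner_conj_symm, inner_conj_symm, hsym]
  rw [inner_star_mul_mul_apply, blockUnitary_apply hψ, blockUnitary_apply hψ, ← hx, ← hy]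
  simp only [map_add, map_smul, inner_add_left, inner_add_right, inner_smul_left,
    inner_smul_right, inner_conj_symm, Complex.add_re, ← hx, ← hy, inner_compression,
    inner_apply_self_eq_avg hH, Submodule.inner_orthogonalProjectionOnto_eq_of_mem_left]
  rw [← hcross, ← Complex.re_mul_ofReal]
  ring_nf
  rw [Complex.add_re]
  ring

/-- Adjoining `ψ` to an eigenbasis of the compression gives an orthonormal basis of the whole space,
in which both traces are computed; `|lam i| = |⟨b i, H b i⟩| ≤ ‖H (b i)‖` gives the last bound. -/
theorem exists_eigenbasis_compression (hψ : ‖ψ‖ = 1) {H : Op d}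
    (hH : IsSelfAdjoint H) :
    ∃ (b : OrthonormalBasis (Fin (Module.finrank ℂ (orthCompl ψ))) ℂ (orthCompl ψ))
      (lam : Fin (Module.finrank ℂ (orthCompl ψ)) → ℝ),
      (∀ i, compression H ψ (b i) = (lam i : ℂ) • b i) ∧
      ∑ i, lam i = H.tr - H.avg ψ ∧ ∑ i, lam i ^ 2 ≤ H.hsNormSq := by
  have hsym : (compression H ψ).toLinearMap.IsSymmetric := by
    intro x y
    have h : ∀ z w : Hil d, inner ℂ (H z) w = inner ℂ z (H w) :=
      ContinuousLinearMap.isSelfAdjoint_iff_isSymmetric.mp hH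
    change inner ℂ (compression H ψ x) y = inner ℂ x (compression H ψ y)
    rw [inner_compression, ← inner_conj_symm, inner_compression, inner_conj_symm, h]
  let b := hsym.eigenvectorBasis rfl
  let lam := hsym.eigenvalues rfl
  have hb : ∀ i, compression H ψ (b i) = (lam i : ℂ) • b i := hsym.apply_eigenvectorBasis rfl
  have hlam : ∀ i, ((lam i : ℝ) : ℂ) = inner ℂ (b i : Hil d) (H (b i : Hil d)) := fun i => by
    rw [← inner_compression, hb, inner_smul_right, inner_self_eq_norm_sq_to_K, b.norm_eq_one]
    simp
  have hfin : Module.finrank ℂ (Hil d) =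
      Fintype.card (Option (Fin (Module.finrank ℂ (orthCompl ψ)))) := by
    have h := Submodule.finrank_add_finrank_orthogonal (Submodule.span ℂ {ψ})
    rw [finrank_span_singleton (by rintro rfl; simp at hψ)] at h
    rw [Fintype.card_option, Fintype.card_fin, ← h, add_comm]
  let v : Option (Fin (Module.finrank ℂ (orthCompl ψ))) → Hil d := fun o =>
    o.elim ψ fun i => (b i : Hil d)
  have hv : Orthonormal ℂ v := by
    refine ⟨?_, ?_⟩
    · rintro (_ | i)
      · exact hψ
      · exact b.norm_eq_one i
    · rintro (_ | i) (_ | j) hij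
      · exact absurd rfl hij
      · exact inner_orthCompl_right _
      · exact inner_orthCompl_left _
      · exact b.orthonormal.2 fun h => hij (by rw [h])
  obtain ⟨B, hB⟩ := Orthonormal.exists_orthonormalBasis_extension_of_card_eq hfin
    (v := v) (s := Set.univ) (hv.comp _ Subtype.val_injective)
  have htr : ∀ A : Op d, A.tr = A.avg ψ + ∑ i, A.avg (b i : Hil d) := by
    intro A
    rw [Op.tr, LinearMap.trace_eq_sum_inner _ B, Fintype.sum_option, Complex.add_re, Complex.re_sum,
      hB _ trivial]
    congr 1
    refine Finset.sum_congr rfl fun i _ => ?_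
    rw [hB _ trivial]
    rfl
  have havg : ∀ i, H.avg (b i : Hil d) = lam i := fun i => by
    rw [Op.avg, ← hlam, Complex.ofReal_re]
  have hsq : ∀ φ : Hil d, (star H * H).avg φ = ‖H φ‖ ^ 2 := fun φ => by
    rw [Op.avg, ContinuousLinearMap.star_eq_adjoint]
    change (inner ℂ φ (ContinuousLinearMap.adjoint H (H φ))).re = _
    rw [ContinuousLinearMap.adjoint_inner_right, inner_self_eq_norm_sq_to_K]
    norm_cast
  refine ⟨b, lam, hb, ?_, ?_⟩
  · rw [htr H, Finset.sum_congr rfl fun i _ => havg i]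
    ring
  · rw [Op.hsNormSq, htr, hsq]
    refine (Finset.sum_le_sum fun i _ => ?_).trans (le_add_of_nonneg_left (sq_nonneg _))
    rw [hsq, ← sq_abs]
    refine pow_le_pow_left₀ (abs_nonneg _) ?_ 2
    have h1 := norm_inner_le_norm (𝕜 := ℂ) (b i : Hil d) (H (b i : Hil d))
    have h2 : ‖(b i : Hil d)‖ = 1 := b.norm_eq_one i
    rw [← hlam, Complex.norm_real, h2, one_mul] at h1
    exact h1

theorem norm_projection_apply_sq (hψ : ‖ψ‖ = 1) {H : Op d} (hH : IsSelfAdjoint H) :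
    ‖(orthCompl ψ).orthogonalProjectionOnto (H ψ)‖ ^ 2 = (H ^ 2).avg ψ - H.avg ψ ^ 2 := by
  have h := inner_eq_mul_add_inner_projection hψ (H ψ) (H ψ)
  have h1 : inner ℂ (H ψ) (H ψ) = inner ℂ ψ ((H ^ 2) ψ) := by
    rw [sq]
    exact ContinuousLinearMap.isSelfAdjoint_iff_isSymmetric.mp hH ψ (H ψ)
  have h2 := congrArg Complex.re h
  rw [h1, ← inner_conj_symm (H ψ) ψ, inner_apply_self_eq_avg hH, inner_self_eq_norm_sq_to_K,
    Complex.conj_ofReal] at h2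
  have h3 : (H ^ 2).avg ψ = H.avg ψ ^ 2 +
      ‖(orthCompl ψ).orthogonalProjectionOnto (H ψ)‖ ^ 2 := by
    rw [Op.avg, h2, sq (H.avg ψ)]
    norm_cast
  linarith

theorem norm_projection_le (φ : Hil d) : ‖(orthCompl ψ).orthogonalProjectionOnto φ‖ ≤ ‖φ‖ :=
  (orthCompl ψ).norm_orthogonalProjectionOnto_apply_le φ

end Block

/-! ### Smallest eigenvalue and positive definiteness -/

section MatrixBounds

variable {M : ℕ}

theorem isHermitian_smul_one (r : ℝ) : (r • (1 : Matrix (Fin M) (Fin M) ℝ)).IsHermitian := by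
  rw [Matrix.IsHermitian, Matrix.conjTranspose_smul, Matrix.conjTranspose_one, star_trivial]

theorem minEigenvalue_mul_dotProduct_le {A : Matrix (Fin M) (Fin M) ℝ} (hA : A.IsHermitian)
    (x : Fin M → ℝ) : minEigenvalue A * (x ⬝ᵥ x) ≤ x ⬝ᵥ A.mulVec x := by
  have hB : (A - algebraMap ℝ _ (minEigenvalue A)).IsHermitian := by
    refine hA.sub ?_
    rw [Algebra.algebraMap_eq_smul_one]
    exact isHermitian_smul_one _
  have hpos : (A - algebraMap ℝ _ (minEigenvalue A)).PosSemidef := by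
    rw [hB.posSemidef_iff_eigenvalues_nonneg]
    intro i
    have h1 : hB.eigenvalues i ∈ spectrum ℝ (A - algebraMap ℝ _ (minEigenvalue A)) := by
      rw [hB.spectrum_real_eq_range_eigenvalues]
      exact ⟨i, rfl⟩
    rw [← spectrum.add_mem_add_iff (s := minEigenvalue A), add_sub_cancel] at h1
    have hbdd : BddBelow (spectrum ℝ A) := by
      rw [hA.spectrum_real_eq_range_eigenvalues]
      exact (Set.finite_range _).bddBelow
    have h2 : minEigenvalue A ≤ _ := csInf_le hbdd h1
    simpa using h2
  have h := hpos.dotProduct_mulVec_nonneg x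
  rw [Algebra.algebraMap_eq_smul_one, Matrix.sub_mulVec, Matrix.smul_mulVec, Matrix.one_mulVec,
    star_trivial, dotProduct_sub, dotProduct_smul, smul_eq_mul] at h
  linarith

/-- A Frobenius-norm perturbation criterion for positive definiteness. -/
theorem posDef_add_smul_one_of_sum_sq_lt {S F : Matrix (Fin M) (Fin M) ℝ} (hS : S.IsHermitian)
    (hF : F.IsHermitian) {c ε : ℝ} (hc : 0 ≤ c) (hg : 0 < c * minEigenvalue F + ε)
    (h : ∑ μ, ∑ ν, (S μ ν - c * F μ ν) ^ 2 < (c * minEigenvalue F + ε) ^ 2) :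
    (S + ε • (1 : Matrix (Fin M) (Fin M) ℝ)).PosDef := by
  refine Matrix.PosDef.of_dotProduct_mulVec_pos
    (hS.add (isHermitian_smul_one _)) fun x hx => ?_
  have hxx : 0 < x ⬝ᵥ x := by
    have := Matrix.dotProduct_star_self_pos_iff.mpr hx
    rwa [star_trivial] at this
  have h1 := mul_le_mul_of_nonneg_left (minEigenvalue_mul_dotProduct_le hF x) hc
  have h2 : x ⬝ᵥ S.mulVec x = c * (x ⬝ᵥ F.mulVec x) + x ⬝ᵥ (S - c • F).mulVec x := by
    rw [Matrix.sub_mulVec, Matrix.smul_mulVec, dotProduct_sub, dotProduct_smul, smul_eq_mul]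
    ring
  -- Cauchy-Schwarz over pairs of indices, between `x ⊗ x` and the matrix `S - c F`.
  have h3 : (x ⬝ᵥ (S - c • F).mulVec x) ^ 2 ≤
      (x ⬝ᵥ x) ^ 2 * ∑ μ, ∑ ν, (S μ ν - c * F μ ν) ^ 2 := by
    have hcs := Finset.sum_mul_sq_le_sq_mul_sq (Finset.univ : Finset (Fin M × Fin M))
      (fun p => x p.1 * x p.2) fun p => S p.1 p.2 - c * F p.1 p.2
    rw [Fintype.sum_prod_type, Fintype.sum_prod_type, Fintype.sum_prod_type] at hcs
    change (∑ μ, ∑ ν, x μ * x ν * (S μ ν - c * F μ ν)) ^ 2 ≤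
      (∑ μ, ∑ ν, (x μ * x ν) ^ 2) * ∑ μ, ∑ ν, (S μ ν - c * F μ ν) ^ 2 at hcs
    convert hcs using 2
    · simp only [dotProduct, Matrix.mulVec, Finset.mul_sum, Matrix.sub_apply, Matrix.smul_apply,
        smul_eq_mul]
      exact Finset.sum_congr rfl fun i _ => Finset.sum_congr rfl fun j _ => by ring
    · rw [sq, dotProduct, Finset.sum_mul_sum]
      exact Finset.sum_congr rfl fun i _ => Finset.sum_congr rfl fun j _ => by ring
  have h4 : (x ⬝ᵥ (S - c • F).mulVec x) ^ 2 < ((x ⬝ᵥ x) * (c * minEigenvalue F + ε)) ^ 2 := by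
    rw [mul_pow]
    exact h3.trans_lt (mul_lt_mul_of_pos_left h (by positivity))
  have h5 := (abs_lt.mp (abs_lt_of_sq_lt_sq h4 (by positivity))).1
  rw [star_trivial, Matrix.add_mulVec, Matrix.smul_mulVec, Matrix.one_mulVec, dotProduct_add,
    dotProduct_smul, smul_eq_mul, h2]
  linarith

end MatrixBounds

/-! ### The random loss: expansion, moments and tail bound -/

theorem finrank_orthCompl_add_one {d : ℕ} {ψ : Hil d} (hψ : ‖ψ‖ = 1) :
    Module.finrank ℂ (orthCompl ψ) + 1 = d := by
  have h := Submodule.finrank_add_finrank_orthogonal (Submodule.span ℂ {ψ})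
  rw [finrank_span_singleton (by rintro rfl; simp at hψ), finrank_euclideanSpace,
    Fintype.card_fin] at h
  rw [add_comm]
  exact h

namespace QNN

variable {d M : ℕ} (Q : QNN d M)

/-- The loss of the observable `H` conjugated by the block-diagonal unitary of `u`. -/
noncomputable def randomLoss (H : Op d) (θ₀ : Fin M → ℝ)
    (u : UnitaryOps (orthCompl (Q.state θ₀))) : (Fin M → ℝ) → ℝ :=
  Q.energyLoss (star (blockUnitary (Q.state θ₀) u) * H * blockUnitary (Q.state θ₀) u)

/-- The component of `∂_μ ψ` orthogonal to `ψ`. -/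
noncomputable def tangent (θ : Fin M → ℝ) (μ : Fin M) : orthCompl (Q.state θ) :=
  (orthCompl (Q.state θ)).orthogonalProjectionOnto (Q.derivState (Pi.single μ 1) θ)

/-- The vector of `ψ^⊥` through which the second derivatives depend linearly on `u`. -/
noncomputable def curvature (θ : Fin M → ℝ) (μ ν : Fin M) : orthCompl (Q.state θ) :=
  (orthCompl (Q.state θ)).orthogonalProjectionOnto (Q.derivState (Pi.single ν 1 + Pi.single μ 1) θ) +
    (inner ℂ (Q.derivState (Pi.single ν 1) θ) (Q.state θ) • Q.tangent θ μ +
      inner ℂ (Q.derivState (Pi.single μ 1) θ) (Q.state θ) • Q.tangent θ ν)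

theorem norm_tangent_le [NeZero d] (θ : Fin M → ℝ) (μ : Fin M) :
    ‖Q.tangent θ μ‖ ≤ ‖Q.generator μ‖ :=
  (norm_projection_le _).trans (Q.norm_derivState_single_le θ μ)

/-- Each of the three summands contributes one; the square of this `3` is the `9` in the fluctuation
bound. -/
theorem norm_curvature_le [NeZero d] (θ : Fin M → ℝ) (μ ν : Fin M) :
    ‖Q.curvature θ μ ν‖ ≤ 3 * (‖Q.generator μ‖ * ‖Q.generator ν‖) := by
  have hin : ∀ κ, ‖inner ℂ (Q.derivState (Pi.single κ 1) θ) (Q.state θ)‖ ≤ ‖Q.generator κ‖ :=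
    fun κ => by
      have h := norm_inner_le_norm (𝕜 := ℂ) (Q.derivState (Pi.single κ 1) θ) (Q.state θ)
      rw [Q.norm_state, mul_one] at h
      exact h.trans (Q.norm_derivState_single_le θ κ)
  have h1 := (norm_projection_le (ψ := Q.state θ) _).trans
    (Q.norm_derivState_single_add_single_le θ ν μ)
  have h2 : ∀ κ κ', ‖inner ℂ (Q.derivState (Pi.single κ 1) θ) (Q.state θ) • Q.tangent θ κ'‖ ≤
      ‖Q.generator κ‖ * ‖Q.generator κ'‖ := fun κ κ' => by
    rw [norm_smul]
    exact mul_le_mul (hin κ) (Q.norm_tangent_le θ κ') (norm_nonneg _) (norm_nonneg _)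
  refine (norm_add_le_of_le h1 (norm_add_le_of_le (h2 ν μ) (h2 μ ν))).trans_eq ?_
  ring

theorem qfi_apply (θ : Fin M → ℝ) (μ ν : Fin M) :
    Q.qfi θ μ ν = 2 * (inner ℂ (Q.tangent θ μ) (Q.tangent θ ν)).re := by
  rw [qfi, Matrix.of_apply, partialD_state, partialD_state,
    inner_eq_mul_add_inner_projection (Q.norm_state θ) (Q.derivState (Pi.single μ 1) θ)
      (Q.derivState (Pi.single ν 1) θ), add_sub_cancel_left]
  rfl

theorem qfi_isHermitian (θ : Fin M → ℝ) : (Q.qfi θ).IsHermitian := by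
  ext μ ν
  rw [Matrix.conjTranspose_apply, star_trivial, qfi_apply, qfi_apply, ← inner_conj_symm,
    Complex.conj_re]

theorem hessianMatrix_energyLoss_isHermitian {A : Op d} (hA : IsSelfAdjoint A) (θ : Fin M → ℝ) :
    (hessianMatrix (Q.energyLoss A) θ).IsHermitian := by
  ext μ ν
  rw [Matrix.conjTranspose_apply, star_trivial, Q.hessianMatrix_energyLoss hA,
    Q.hessianMatrix_energyLoss hA, add_comm (Pi.single ν 1 : Fin M → ℕ),
    re_inner_apply_comm_of_isSelfAdjoint hA (Q.derivState (Pi.single μ 1) θ)]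

theorem partialD_randomLoss {H : Op d} (hH : IsSelfAdjoint H) (θ : Fin M → ℝ)
    (u : UnitaryOps (orthCompl (Q.state θ))) (μ : Fin M) :
    partialD μ (Q.randomLoss H θ u) θ =
      2 * (inner ℂ ((u : orthCompl (Q.state θ) →L[ℂ] orthCompl (Q.state θ)) (Q.tangent θ μ))
        ((orthCompl (Q.state θ)).orthogonalProjectionOnto (H (Q.state θ)))).re := by
  rw [randomLoss, Q.partialD_energyLoss (isSelfAdjoint_star_mul_mul _ hH), derivState_zero,
    re_inner_block_apply_self (Q.norm_state θ) hH, Q.re_inner_derivState_state, zero_mul, zero_add]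
  rfl

/-- The `L*` terms combine to `-2 L* Re⟨t_ν, t_μ⟩`, because the components of first derivatives
along `ψ` cancel by normalization. Since `F` is `2 Re⟨t_ν, t_μ⟩`, subtracting `c F` produces the
factor `c + L*`. -/
theorem hessianMatrix_randomLoss_sub {H : Op d} (hH : IsSelfAdjoint H) (θ : Fin M → ℝ)
    (u : UnitaryOps (orthCompl (Q.state θ))) (c : ℝ) (μ ν : Fin M) :
    hessianMatrix (Q.randomLoss H θ u) θ μ ν - c * Q.qfi θ μ ν =
      2 * (inner ℂ ((u : orthCompl (Q.state θ) →L[ℂ] orthCompl (Q.state θ)) (Q.curvature θ μ ν))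
        ((orthCompl (Q.state θ)).orthogonalProjectionOnto (H (Q.state θ)))).re +
      2 * ((inner ℂ ((u : orthCompl (Q.state θ) →L[ℂ] orthCompl (Q.state θ)) (Q.tangent θ ν))
        (compression H (Q.state θ)
          ((u : orthCompl (Q.state θ) →L[ℂ] orthCompl (Q.state θ)) (Q.tangent θ μ)))).re -
        (c + Q.energyLoss H θ) * (inner ℂ (Q.tangent θ ν) (Q.tangent θ μ)).re) := by
  have hin := congrArg Complex.re (inner_eq_mul_add_inner_projection (Q.norm_state θ)
    (Q.derivState (Pi.single ν 1) θ) (Q.derivState (Pi.single μ 1) θ))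
  rw [Complex.add_re] at hin
  change _ = _ + (inner ℂ (Q.tangent θ ν) (Q.tangent θ μ)).re at hin
  have hqfi : Q.qfi θ μ ν = 2 * (inner ℂ (Q.tangent θ ν) (Q.tangent θ μ)).re := by
    rw [← Q.qfi_apply, ← (Q.qfi_isHermitian θ).apply, star_trivial]
  rw [randomLoss, Q.hessianMatrix_energyLoss (isSelfAdjoint_star_mul_mul _ hH),
    re_inner_block_apply_self (Q.norm_state θ) hH, re_inner_block_apply (Q.norm_state θ) hH,
    Q.re_inner_derivState_derivState, hqfi, hin]
  simp only [tangent, energyLoss, curvature, map_add, inner_add_left, Complex.add_re]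
  ring

theorem continuous_partialD_randomLoss {H : Op d} (hH : IsSelfAdjoint H) (θ : Fin M → ℝ)
    (μ : Fin M) : Continuous fun u => partialD μ (Q.randomLoss H θ u) θ := by
  simp only [Q.partialD_randomLoss hH]
  exact (Complex.continuous_re.comp (by fun_prop)).const_mul _

theorem continuous_hessianMatrix_randomLoss {H : Op d} (hH : IsSelfAdjoint H) (θ : Fin M → ℝ)
    (c : ℝ) (μ ν : Fin M) :
    Continuous fun u => hessianMatrix (Q.randomLoss H θ u) θ μ ν - c * Q.qfi θ μ ν := by
  simp only [Q.hessianMatrix_randomLoss_sub hH]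
  refine ((Complex.continuous_re.comp (by fun_prop)).const_mul _).add
    (((Complex.continuous_re.comp (by fun_prop)).sub continuous_const).const_mul _)

theorem f₁_nonneg {H : Op d} (hd : 1 ≤ d) (hH : IsSelfAdjoint H) (θ : Fin M → ℝ) :
    0 ≤ f₁ H (Q.state θ) := by
  rw [f₁, ← norm_projection_apply_sq (Q.norm_state θ) hH]
  have : (1 : ℝ) ≤ d := by exact_mod_cast hd
  exact div_nonneg (sq_nonneg _) (by linarith)

theorem integral_partialD_randomLoss_sq_le {H : Op d} (hd : 3 ≤ d) (hH : IsSelfAdjoint H)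
    (θ : Fin M → ℝ) (μ : Fin M) :
    ∫ u, (partialD μ (Q.randomLoss H θ u) θ) ^ 2 ∂haarUnitary (orthCompl (Q.state θ)) ≤
      2 * f₁ H (Q.state θ) * ‖Q.generator μ‖ ^ 2 := by
  have : NeZero d := ⟨by omega⟩
  have hD : (Module.finrank ℂ (orthCompl (Q.state θ)) : ℝ) = (d : ℝ) - 1 := by
    rw [eq_sub_iff_add_eq]
    exact_mod_cast finrank_orthCompl_add_one (Q.norm_state θ)
  have hd' : (3 : ℝ) ≤ d := by exact_mod_cast hd
  have h := integral_haarUnitary_re_inner_sq (Q.tangent θ μ)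
    ((orthCompl (Q.state θ)).orthogonalProjectionOnto (H (Q.state θ)))
  simp only [Q.partialD_randomLoss hH, mul_pow, integral_const_mul]
  rw [hD, norm_projection_apply_sq (Q.norm_state θ) hH] at h
  have h1 : ‖Q.tangent θ μ‖ ^ 2 ≤ ‖Q.generator μ‖ ^ 2 :=
    pow_le_pow_left₀ (norm_nonneg _) (Q.norm_tangent_le θ μ) 2
  refine le_trans (le_of_eq ?_) (mul_le_mul_of_nonneg_left h1
    (mul_nonneg zero_le_two (Q.f₁_nonneg (by omega) hH θ)))
  rw [f₁]
  field_simp [show (d : ℝ) - 1 ≠ 0 by linarith]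
  linarith

theorem integral_hessianMatrix_randomLoss_sub_sq_le {H : Op d} (hd : 3 ≤ d)
    (hH : IsSelfAdjoint H) (θ : Fin M → ℝ) (μ ν : Fin M) :
    ∫ u, (hessianMatrix (Q.randomLoss H θ u) θ μ ν -
        (H.tr - d * Q.energyLoss H θ) / ((d : ℝ) - 1) * Q.qfi θ μ ν) ^ 2
        ∂haarUnitary (orthCompl (Q.state θ)) ≤
      f₂ H (Q.state θ) * (‖Q.generator μ‖ ^ 2 * ‖Q.generator ν‖ ^ 2) := by
  have : NeZero d := ⟨by omega⟩
  have hfin := finrank_orthCompl_add_one (Q.norm_state θ)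
  have hD : (Module.finrank ℂ (orthCompl (Q.state θ)) : ℝ) = (d : ℝ) - 1 := by
    rw [eq_sub_iff_add_eq]
    exact_mod_cast hfin
  have hd' : (3 : ℝ) ≤ d := by exact_mod_cast hd
  obtain ⟨b, lam, hb, htr, hsq⟩ := exists_eigenbasis_compression (Q.norm_state θ) hH
  simp only [Q.hessianMatrix_randomLoss_sub hH]
  refine (integral_haarUnitary_fluctuation_sq_le (by omega) b hb ?_ _ _ _ _).trans ?_
  -- This `c` is the one for which `c + L* = (tr H - L*)/(d - 1)`, the mean eigenvalue of the
  -- compression.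
  · rw [htr, hD, energyLoss]
    field_simp [show (d : ℝ) - 1 ≠ 0 by linarith]
    ring
  · rw [hD, norm_projection_apply_sq (Q.norm_state θ) hH, f₂]
    have hw : ‖Q.curvature θ μ ν‖ ^ 2 / 9 ≤ ‖Q.generator μ‖ ^ 2 * ‖Q.generator ν‖ ^ 2 := by
      have := pow_le_pow_left₀ (norm_nonneg _) (Q.norm_curvature_le θ μ ν) 2
      rw [div_le_iff₀ (by norm_num)]
      linarith
    have hx : ‖Q.tangent θ ν‖ ^ 2 * ‖Q.tangent θ μ‖ ^ 2 ≤
        ‖Q.generator μ‖ ^ 2 * ‖Q.generator ν‖ ^ 2 := by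
      rw [mul_comm]
      gcongr
      · exact Q.norm_tangent_le θ μ
      · exact Q.norm_tangent_le θ ν
    have hf := Q.f₁_nonneg (by omega) hH θ
    rw [f₁] at hf
    have hq : 2 * (∑ i, lam i ^ 2) / (((d : ℝ) - 1 + 1) * ((d : ℝ) - 1 - 1)) ≤
        2 * H.hsNormSq / ((d : ℝ) * ((d : ℝ) - 2)) := by
      rw [show ((d : ℝ) - 1 + 1) * ((d : ℝ) - 1 - 1) = (d : ℝ) * ((d : ℝ) - 2) by ring]
      refine div_le_div_of_nonneg_right (by linarith) ?_
      nlinarith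
    have hq0 : 0 ≤ 2 * (∑ i, lam i ^ 2) / (((d : ℝ) - 1 + 1) * ((d : ℝ) - 1 - 1)) := by
      refine div_nonneg (mul_nonneg zero_le_two (Finset.sum_nonneg fun i _ => sq_nonneg _)) ?_
      nlinarith
    have h1 := mul_le_mul_of_nonneg_left hw hf
    have h2 := mul_le_mul hq hx (by positivity) (hq0.trans hq)
    linarith

theorem norm_omega_sq : ‖Q.omega‖ ^ 2 = ∑ μ, ‖Q.generator μ‖ ^ 2 := by
  rw [EuclideanSpace.norm_sq_eq]
  simp [omega]

theorem measureReal_not_localMin_le {H : Op d} (hd : 3 ≤ d) (hH : IsSelfAdjoint H)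
    (θ : Fin M → ℝ) {ε₁ ε₂ : ℝ} (hε₁ : 0 < ε₁)
    (hε₂ : 0 < (H.tr - d * Q.energyLoss H θ) / ((d : ℝ) - 1) * minEigenvalue (Q.qfi θ) + ε₂)
    (hL : Q.energyLoss H θ < H.tr / d) :
    (haarUnitary (orthCompl (Q.state θ))).real {u | ¬ LocalMin (Q.randomLoss H θ u) θ ε₁ ε₂} ≤
      2 * f₁ H (Q.state θ) * ‖Q.omega‖ ^ 2 / ε₁ ^ 2 +
        f₂ H (Q.state θ) * ‖Q.omega‖ ^ 4 /
          ((H.tr - d * Q.energyLoss H θ) / ((d : ℝ) - 1) * minEigenvalue (Q.qfi θ) + ε₂) ^ 2 := by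
  set c := (H.tr - d * Q.energyLoss H θ) / ((d : ℝ) - 1) with hc
  set g := c * minEigenvalue (Q.qfi θ) + ε₂ with hg
  have hd' : (3 : ℝ) ≤ d := by exact_mod_cast hd
  have hc0 : 0 ≤ c := by
    rw [lt_div_iff₀ (by linarith)] at hL
    exact div_nonneg (by linarith) (by linarith)
  let G : Fin M → UnitaryOps (orthCompl (Q.state θ)) → ℝ := fun μ u =>
    (partialD μ (Q.randomLoss H θ u) θ) ^ 2
  let Z : UnitaryOps (orthCompl (Q.state θ)) → ℝ := fun u =>
    ∑ μ, ∑ ν, (hessianMatrix (Q.randomLoss H θ u) θ μ ν - c * Q.qfi θ μ ν) ^ 2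
  -- One bad event per gradient component, but a single Frobenius-norm event for the whole Hessian.
  have hsub : {u | ¬ LocalMin (Q.randomLoss H θ u) θ ε₁ ε₂} ⊆
      (⋃ μ, {u | ε₁ ^ 2 ≤ G μ u}) ∪ {u | g ^ 2 ≤ Z u} := by
    intro u hu
    by_contra hcon
    simp only [Set.mem_union, Set.mem_iUnion, Set.mem_ofPred_eq, not_or, not_exists, not_le] at hcon
    refine hu ⟨fun μ => (abs_lt_of_sq_lt_sq (hcon.1 μ) hε₁.le).le, ?_⟩
    exact posDef_add_smul_one_of_sum_sq_lt
      (Q.hessianMatrix_energyLoss_isHermitian (isSelfAdjoint_star_mul_mul _ hH) θ)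
      (Q.qfi_isHermitian θ) hc0 hε₂ hcon.2
  have hGc : ∀ μ, Continuous (G μ) := fun μ => (Q.continuous_partialD_randomLoss hH θ μ).pow 2
  have hZc : ∀ μ ν, Continuous fun u =>
      (hessianMatrix (Q.randomLoss H θ u) θ μ ν - c * Q.qfi θ μ ν) ^ 2 := fun μ ν =>
    (Q.continuous_hessianMatrix_randomLoss hH θ c μ ν).pow 2
  have hZi : Continuous Z := continuous_finsetSum _ fun μ _ =>
    continuous_finsetSum _ fun ν _ => hZc μ ν
  have hG : ∀ μ, (haarUnitary (orthCompl (Q.state θ))).real {u | ε₁ ^ 2 ≤ G μ u} ≤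
      2 * f₁ H (Q.state θ) * ‖Q.generator μ‖ ^ 2 / ε₁ ^ 2 := fun μ => by
    rw [le_div_iff₀ (by positivity), mul_comm]
    exact (mul_meas_ge_le_integral_of_nonneg (ae_of_all _ fun u => sq_nonneg _)
      (hGc μ).integrable_haarUnitary _).trans (Q.integral_partialD_randomLoss_sq_le hd hH θ μ)
  have hZ : (haarUnitary (orthCompl (Q.state θ))).real {u | g ^ 2 ≤ Z u} ≤
      f₂ H (Q.state θ) * ‖Q.omega‖ ^ 4 / g ^ 2 := by
    rw [le_div_iff₀ (by positivity), mul_comm]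
    refine (mul_meas_ge_le_integral_of_nonneg (ae_of_all _ fun u =>
      Finset.sum_nonneg fun _ _ => Finset.sum_nonneg fun _ _ => sq_nonneg _)
      hZi.integrable_haarUnitary _).trans ?_
    rw [integral_finsetSum _ fun μ _ => (continuous_finsetSum _ fun ν _ =>
      hZc μ ν).integrable_haarUnitary]
    have hω : f₂ H (Q.state θ) * ‖Q.omega‖ ^ 4 = ∑ μ, ∑ ν,
        f₂ H (Q.state θ) * (‖Q.generator μ‖ ^ 2 * ‖Q.generator ν‖ ^ 2) := by
      rw [show ‖Q.omega‖ ^ 4 = ‖Q.omega‖ ^ 2 * ‖Q.omega‖ ^ 2 by ring, norm_omega_sq,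
        Finset.sum_mul_sum, Finset.mul_sum]
      exact Finset.sum_congr rfl fun μ _ => Finset.mul_sum _ _ _
    rw [hω]
    refine Finset.sum_le_sum fun μ _ => ?_
    rw [integral_finsetSum _ fun ν _ => (hZc μ ν).integrable_haarUnitary]
    exact Finset.sum_le_sum fun ν _ => Q.integral_hessianMatrix_randomLoss_sub_sq_le hd hH θ μ ν
  refine (measureReal_mono hsub).trans ((measureReal_union_le _ _).trans (add_le_add ?_ hZ))
  refine (measureReal_iUnion_fintype_le _).trans ((Finset.sum_le_sum fun μ _ => hG μ).trans_eq ?_)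
  rw [norm_omega_sq, Finset.mul_sum, Finset.sum_div]

end QNN

/-! ### Asymptotics of the coefficients -/

section Asymptotics

theorem abs_avg_le {d : ℕ} (A : Op d) {ψ : Hil d} (hψ : ‖ψ‖ = 1) : |A.avg ψ| ≤ ‖A‖ := by
  refine (Complex.abs_re_le_norm _).trans ((norm_inner_le_norm _ _).trans ?_)
  rw [hψ, one_mul]
  simpa [hψ] using A.le_opNorm ψ

theorem abs_variance_le {d : ℕ} (A : Op d) {ψ : Hil d} (hψ : ‖ψ‖ = 1) :
    |(A ^ 2).avg ψ - A.avg ψ ^ 2| ≤ 2 * ‖A‖ ^ 2 := by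
  have h1 : |(A ^ 2).avg ψ| ≤ ‖A‖ ^ 2 :=
    (abs_avg_le _ hψ).trans (norm_pow_le' A two_pos)
  have h2 : |A.avg ψ ^ 2| ≤ ‖A‖ ^ 2 := by
    rw [abs_pow]
    exact pow_le_pow_left₀ (abs_nonneg _) (abs_avg_le A hψ) 2
  have := abs_sub ((A ^ 2).avg ψ) (A.avg ψ ^ 2)
  linarith

theorem abs_hsNormSq_le {d : ℕ} (A : Op d) : |A.hsNormSq| ≤ d * ‖A‖ ^ 2 := by
  rw [Op.hsNormSq, Op.tr, LinearMap.trace_eq_sum_inner _ (EuclideanSpace.basisFun (Fin d) ℂ),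
    Complex.re_sum]
  refine (Finset.abs_sum_le_sum_abs _ _).trans ?_
  refine (Finset.sum_le_card_nsmul _ _ (‖A‖ ^ 2) fun i _ => ?_).trans_eq (by simp)
  refine (abs_avg_le (star A * A) ((EuclideanSpace.basisFun (Fin d) ℂ).norm_eq_one i)).trans ?_
  rw [sq, ContinuousLinearMap.star_eq_adjoint]
  exact (ContinuousLinearMap.norm_adjoint_comp_self A).le

theorem abs_f₁_le {d : ℕ} (hd : 4 ≤ d) (A : Op d) {ψ : Hil d} (hψ : ‖ψ‖ = 1) :
    |f₁ A ψ| ≤ 4 * (‖A‖ ^ 2 * (d : ℝ)⁻¹) := by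
  have hd' : (4 : ℝ) ≤ d := by exact_mod_cast hd
  rw [f₁, abs_div, abs_of_pos (by linarith : (0 : ℝ) < d - 1), div_le_iff₀ (by linarith)]
  refine (abs_variance_le A hψ).trans ?_
  have h : 1 ≤ 2 * ((d : ℝ)⁻¹ * (d - 1)) := by
    field_simp
    linarith
  nlinarith [sq_nonneg ‖A‖]

/-- For `d ≥ 4` both `d - 1` and `d - 2` are at least `d / 2`, so each summand is at most `4 ‖A‖² /
d`, and `256 = 32 · (4 + 4)`. -/
theorem abs_f₂_le {d : ℕ} (hd : 4 ≤ d) (A : Op d) {ψ : Hil d} (hψ : ‖ψ‖ = 1) :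
    |f₂ A ψ| ≤ 256 * (‖A‖ ^ 2 * (d : ℝ)⁻¹) := by
  have hd' : (4 : ℝ) ≤ d := by exact_mod_cast hd
  have h1 : |2 * A.hsNormSq / ((d : ℝ) * ((d : ℝ) - 2))| ≤ 4 * (‖A‖ ^ 2 * (d : ℝ)⁻¹) := by
    have hp : 0 < (d : ℝ) * ((d : ℝ) - 2) := mul_pos (by linarith) (by linarith)
    rw [abs_div, abs_of_pos hp, div_le_iff₀ hp, abs_mul, abs_two]
    have h2 : 4 * (‖A‖ ^ 2 * (d : ℝ)⁻¹) * ((d : ℝ) * (d - 2)) = 4 * ‖A‖ ^ 2 * (d - 2) := by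
      field_simp
    rw [h2]
    nlinarith [abs_hsNormSq_le A, sq_nonneg ‖A‖]
  rw [f₂, abs_mul, abs_of_pos (by norm_num : (0 : ℝ) < 32)]
  have h3 := abs_f₁_le hd A hψ
  rw [f₁] at h3
  have h4 := abs_add_le (((A ^ 2).avg ψ - A.avg ψ ^ 2) / ((d : ℝ) - 1))
    (2 * A.hsNormSq / ((d : ℝ) * ((d : ℝ) - 2)))
  linarith

theorem isBigO_of_abs_le_norm_sq {H : ∀ N : ℕ, Op (2 ^ N)} {k : ℕ}
    (hk : (fun N => ‖H N‖) =O[atTop] fun N : ℕ => (N : ℝ) ^ k) {f : ℕ → ℝ} {C : ℝ}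
    (hf : ∀ N, 4 ≤ 2 ^ N → |f N| ≤ C * (‖H N‖ ^ 2 * ((2 ^ N : ℕ) : ℝ)⁻¹)) :
    f =O[atTop] fun N : ℕ => (N : ℝ) ^ (k * 2) * (2 : ℝ)⁻¹ ^ N := by
  have h1 : f =O[atTop] fun N => ‖H N‖ ^ 2 * (2 : ℝ)⁻¹ ^ N := by
    refine IsBigO.of_bound C ?_
    filter_upwards [eventually_ge_atTop 2] with N hN
    have h4 : 4 ≤ 2 ^ N := (Nat.pow_le_pow_right two_pos hN : 2 ^ 2 ≤ 2 ^ N)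
    rw [Real.norm_eq_abs, Real.norm_of_nonneg (by positivity)]
    simpa using hf N h4
  refine h1.trans (IsBigO.mul ?_ (isBigO_refl _ _))
  simpa only [pow_mul] using hk.pow 2

end Asymptotics

theorem mainTheorem4 :
    (∀ (d M : ℕ) (_hd : 3 ≤ d) (Q : QNN d M) (H : Op d) (_hH : IsSelfAdjoint H)
        (θ : Fin M → ℝ) (ε₁ ε₂ : ℝ) (_hε₁ : 0 < ε₁)
        (_hε₂ : 0 < (H.tr - d * Q.energyLoss H θ) / ((d : ℝ) - 1) * minEigenvalue (Q.qfi θ) + ε₂)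
        (_hL : Q.energyLoss H θ < H.tr / d),
        (haarUnitary (orthCompl (Q.state θ))).real
            {u | ¬ LocalMin
              (Q.energyLoss (star (blockUnitary (Q.state θ) u) * H * blockUnitary (Q.state θ) u))
              θ ε₁ ε₂}
          ≤ 2 * f₁ H (Q.state θ) * ‖Q.omega‖ ^ 2 / ε₁ ^ 2
            + f₂ H (Q.state θ) * ‖Q.omega‖ ^ 4
              / ((H.tr - d * Q.energyLoss H θ) / ((d : ℝ) - 1) * minEigenvalue (Q.qfi θ)
                  + ε₂) ^ 2) ∧
    (∀ (H : ∀ N : ℕ, Op (2 ^ N)) (ψ : ∀ N : ℕ, Hil (2 ^ N)),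
        (∀ N, IsSelfAdjoint (H N)) → (∀ N, ‖ψ N‖ = 1) →
        (∃ k : ℕ, (fun N => ‖H N‖) =O[atTop] fun N : ℕ => (N : ℝ) ^ k) →
        ∃ k : ℕ,
          (fun N => f₁ (H N) (ψ N)) =O[atTop] (fun N : ℕ => (N : ℝ) ^ k * (2 : ℝ)⁻¹ ^ N) ∧
          (fun N => f₂ (H N) (ψ N)) =O[atTop] (fun N : ℕ => (N : ℝ) ^ k * (2 : ℝ)⁻¹ ^ N)) := by
  refine ⟨fun d M hd Q H hH θ ε₁ ε₂ hε₁ hε₂ hL =>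
    Q.measureReal_not_localMin_le hd hH θ hε₁ hε₂ hL, fun H ψ _ hψ ⟨k, hk⟩ => ⟨k * 2, ?_, ?_⟩⟩
  · exact isBigO_of_abs_le_norm_sq hk fun N hN => abs_f₁_le hN (H N) (hψ N)
  · exact isBigO_of_abs_le_norm_sq hk fun N hN => abs_f₂_le hN (H N) (hψ N)
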